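/- A tubular group with a single vertex group is the fundamental group $G$ of a finite graph of groups whose underlying graph has exactly one vertex, with vertex group $G_v\cong\mathbb{Z}^2$ and edge groups $G_e\cong\mathbb{Z}$ $(e\in\mathcal{E})$, where $\mathcal{E}$ is the finite (possibly empty) set of edges, with injective attaching maps $\varphi_e^{-},\varphi_e^{+}:G_e\to G_v$. That is, $G$ is the quotient of the free product of $G_v$ with the free group on letters $t_e$ $(e\in\mathcal{E})$ by the relations $t_e\,\varphi_e^{-}(g)\,t_e^{-1}=\varphi_e^{+}(g)$ for all $e\in\mathcal{E}$, $g\in G_e$. Writing $G_v$ and the $G_e$ additively, for a tuple of integers $\underline{k}=(k_e)_{e\in\mathcal{E}}$ let $G_v^{(\underline{k})}\leqslant G_v$ be the subgroup generated by all $\varphi_e^{-}(k_eG_e)$ and $\varphi_e^{+}(k_eG_e)$. An element $x$ of a subgroup $H\leqslant G_v$ is primitive in $H$ if $x\neq 0$ and $x=ny$ with $n\in\mathbb{Z}$, $y\in H$ implies $n=\pm1$. The tuple $\underline{k}$ is a regulating $\mathcal{E}$-tuple if for every $e\in\mathcal{E}$ and every generator $g_e$ of $G_e$ both $\varphi_e^{-}(k_eg_e)$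 and $\varphi_e^{+}(k_eg_e)$ are primitive in $G_v^{(\underline{k})}$. After choosing an enumeration $e_1,\dots,e_n$ of $\mathcal{E}$ $(n\geq 0)$, an identification $G_v=\mathbb{Z}^2$ and generators $g_{e_i}$ of the edge groups, such a graph of groups is described by the finite list $\big((u_1,v_1),\dots,(u_n,v_n)\big)$ of pairs of vectors of $\mathbb{Z}^2$, where $u_i=\varphi_{e_i}^{-}(g_{e_i})$ and $v_i=\varphi_{e_i}^{+}(g_{e_i})$. Theorem. There is a single algorithm (a total computable function with values in $\{\text{yes},\text{no}\}$) which, given as input any list describing a tubular group $G$ with a single vertex group, halts after finitely many steps and answers "yes" if and only if $G$ is residually finite. Moreover, it answers "yes" if and only if $G$ has a regulating $\mathcal{E}$-tuple; in particular, for these groups, residual finiteness is equivalent to the existence of a regulating $\mathcal{E}$-tuple. -/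

import Mathlib

universe u v w

/-- A finite graph of groups over a graph with exactly one vertex, whose vertex group is
isomorphic to `ℤ²` and whose edge groups are isomorphic to `ℤ`. All the vertex and edge groups are
abelian and are written additively. The edges are directed loops; `neg e` and `pos e` are the two
inclusions of the edge group of `e` in the vertex group. -/
structure OneVertexTubular where
  /-- The set of edges of the underlying graph. -/
  E : Type u
  finite_E : Finite E
  /-- The vertex group. -/
  Vert : Type v
  [addCommGroupVert : AddCommGroup Vert]
  /-- The edge groups. -/
  Edge : E → Type w
  [addCommGroupEdge : ∀ e, AddCommGroup (Edge e)]
  vert_iso : Nonempty (Vert ≃+ ℤ × ℤ)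
  edge_iso : ∀ e, Nonempty (Edge e ≃+ ℤ)
  /-- The inclusion of an edge group at its initial end. -/
  neg : ∀ e, Edge e →+ Vert
  /-- The inclusion of an edge group at its terminal end. -/
  pos : ∀ e, Edge e →+ Vert
  neg_injective : ∀ e, Function.Injective (neg e)
  pos_injective : ∀ e, Function.Injective (pos e)

/-- `x` is a primitive element of the subgroup `H`: it is a nontrivial element of `H` which is not
a proper multiple of an element of `H`. -/
def IsPrimitiveIn {A : Type*} [AddCommGroup A] (H : AddSubgroup A) (x : A) : Prop :=
  x ∈ H ∧ x ≠ 0 ∧ ∀ (n : ℤ) (y : A), y ∈ H → n • y = x → n = 1 ∨ n = -1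

namespace OneVertexTubular

attribute [instance] OneVertexTubular.addCommGroupVert OneVertexTubular.addCommGroupEdge

/-- The relators `t_e φ⁻_e(g) t_e⁻¹ φ⁺_e(g)⁻¹`, in the free product of the vertex group with the
free group on the stable letters `t_e`. -/
def relators (T : OneVertexTubular.{u, v, w}) :
    Set (Monoid.Coprod (Multiplicative T.Vert) (FreeGroup T.E)) :=
  {r | ∃ (e : T.E) (g : T.Edge e),
    r = Monoid.Coprod.inr (FreeGroup.of e) *
        Monoid.Coprod.inl (Multiplicative.ofAdd (T.neg e g)) *
        (Monoid.Coprod.inr (FreeGroup.of e))⁻¹ *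
        (Monoid.Coprod.inl (Multiplicative.ofAdd (T.pos e g)))⁻¹}

/-- The tubular group itself: the fundamental group of the graph of groups, that is the multiple
HNN extension of the vertex group with one stable letter for each edge. -/
abbrev TubularGroup (T : OneVertexTubular.{u, v, w}) : Type (max u v) :=
  Monoid.Coprod (Multiplicative T.Vert) (FreeGroup T.E) ⧸ Subgroup.normalClosure T.relators

/-- For a tuple `k` of integers indexed by the edges, the subgroup `k_e G_e` of the edge group. -/
def edgeSubgroup (T : OneVertexTubular.{u, v, w}) (k : T.E → ℤ) (e : T.E) :
    AddSubgroup (T.Edge e) :=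
  (zsmulAddGroupHom (k e) : T.Edge e →+ T.Edge e).range

/-- The subgroup of the vertex group generated by the images of all the `k_e G_e` under both
attaching maps. -/
def vertexSubgroup (T : OneVertexTubular.{u, v, w}) (k : T.E → ℤ) : AddSubgroup T.Vert :=
  ⨆ e, ((T.edgeSubgroup k e).map (T.neg e) ⊔ (T.edgeSubgroup k e).map (T.pos e))

/-- A tuple is regulating if, for each edge `e` and each generator `g` of its edge group, both
images of `k_e g` are primitive in the subgroup `T.vertexSubgroup k`. -/
def IsRegulating (T : OneVertexTubular.{u, v, w}) (k : T.E → ℤ) : Prop :=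
  ∀ (e : T.E) (g : T.Edge e), AddSubgroup.zmultiples g = ⊤ →
    IsPrimitiveIn (T.vertexSubgroup k) (T.neg e (k e • g)) ∧
    IsPrimitiveIn (T.vertexSubgroup k) (T.pos e (k e • g))

/-- The choices under which the graph of groups becomes finite data: an enumeration of the edges,
a basis of the vertex group, and a generator of each edge group (the image of `1`). -/
structure Marking (T : OneVertexTubular.{u, v, w}) where
  /-- The number of edges. -/
  n : ℕ
  /-- The enumeration of the edges. -/
  edge : Fin n ≃ T.E
  /-- The coordinates on the vertex group. -/
  coord : T.Vert ≃+ ℤ × ℤ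
  /-- The identification of each edge group with `ℤ`. -/
  gen : ∀ e, ℤ ≃+ T.Edge e

/-- The finite data presented to an algorithm: for each edge in turn, the coordinates of the two
elements `φ⁻_e(g_e)` and `φ⁺_e(g_e)` of `ℤ²`, where `g_e` is the chosen generator. -/
def Marking.code {T : OneVertexTubular.{u, v, w}} (M : T.Marking) :
    List ((ℤ × ℤ) × (ℤ × ℤ)) :=
  List.ofFn fun i : Fin M.n =>
    (M.coord (T.neg (M.edge i) (M.gen (M.edge i) 1)),
      M.coord (T.pos (M.edge i) (M.gen (M.edge i) 1)))

end OneVertexTubular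

/-!
Fix generators of the edge groups and coordinates on the vertex group, so that each edge `e` has two
end vectors `w (e, true)` and `w (e, false)` in `ℤ²`, the first being conjugated to the second by the
stable letter `t_e`. A tuple `k` regulates the group if all `k e • w (e, b)` are primitive in the
subgroup `L` that they generate. There are three parts to the proof.

*Regulating tuples give residual finiteness* (`residuallyFinite_of_isRegulated`). After enlarging `L`
to a subgroup of finite index without losing primitivity, the order of `w (e, b)` modulo `N L` is
`N |k e|`, for both values of `b`. So the finite group `ℤ² / N L` is the base group of an HNN
extension which is a quotient of the tubular group, and for suitable `N` a given reduced word stays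
reduced there, as cyclic subgroups of `ℤ²` are separable. A reduced word of length `n` over a base
group `B` acts nontrivially on `n + 1` copies of `B`: reducedness says exactly that the requirement
that its letters walk from the last copy to the first one prescribes partial injections between the
sets of orbits, and these extend to bijections (`exists_perm_wordEval`). For finite `B` this is a
finite quotient; for `B = ℤ²` it is Britton's lemma.

*Residual finiteness gives a regulating tuple* (`exists_isRegulated_of_residuallyFinite`). For each
end vector `u = w (e, b)` and each proper root `z` of `u`, the commutator of the conjugate of `z` by
the stable letter with a vector that is no multiple of the opposite end vector is nontrivial. Take a
finite quotient in which these finitely many commutators survive, and let `k e` be the order of the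
image of `u`, which is the same for both ends of `e`. If `k e • u = p • y` with `p` prime and `y` in `L`, then `y` is killed in the quotient, so `p` does not
divide `k e`; then `u` has a `p`-th root `z` whose image is a power of the image of `u`, and the
commutator of `z` dies, a contradiction.

*The existence of a regulating tuple is decidable* (`isAccepted_iff`). If all the end vectors are
parallel, it means that the two ends of each edge agree up to sign. Otherwise `x` is primitive in `L`
if and only if its determinants with the generators of `L` have the same greatest common divisor as
all the determinants of pairs of generators (`isPrimitiveIn_iff_gcd_dvd`), which is easily checked
for a given tuple. The search for a tuple is bounded: for each prime `p`, the `p`-adic valuations of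
the entries need not leave gaps longer than the valuations `D` of the determinants and coordinates
that are given, since the entries above such a gap can be divided by `p` (`IsTightAt.lower`). Hence
the entries may be taken to divide `M ^ n` for a common multiple `M` of the data
(`exists_tight_dvd`).
-/

/-! ### Determinants, primitive elements and subgroups of `ℤ²` -/

/-- The determinant of two vectors of `ℤ²`. -/
def det (x y : ℤ × ℤ) : ℤ := x.1 * y.2 - x.2 * y.1

theorem det_self (x : ℤ × ℤ) : det x x = 0 := by simp [det, mul_comm]

theorem det_add_right (x y z : ℤ × ℤ) : det x (y + z) = det x y + det x z := by
  simp [det]; ring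

theorem det_add_left (x y z : ℤ × ℤ) : det (x + y) z = det x z + det y z := by
  simp [det]; ring

theorem det_smul_right (m : ℤ) (x y : ℤ × ℤ) : det x (m • y) = m * det x y := by
  simp [det]; ring

theorem det_smul_left (m : ℤ) (x y : ℤ × ℤ) : det (m • x) y = m * det x y := by
  simp [det]; ring

/-- Cramer's rule. -/
theorem det_smul_eq (x y z : ℤ × ℤ) : det y z • x = det x z • y - det x y • z := by
  ext <;> simp [det] <;> ring

theorem smul_left_cancel_intProd {m : ℤ} (hm : m ≠ 0) {x y : ℤ × ℤ} (h : m • x = m • y) : x = y := by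
  have h1 := congrArg Prod.fst h
  have h2 := congrArg Prod.snd h
  simp only [Prod.smul_fst, Prod.smul_snd, smul_eq_mul] at h1 h2
  exact Prod.ext (mul_left_cancel₀ hm h1) (mul_left_cancel₀ hm h2)

theorem smul_ne_zero_intProd {m : ℤ} (hm : m ≠ 0) {x : ℤ × ℤ} (h : x ≠ 0) : m • x ≠ 0 := by
  intro h'
  exact h (smul_left_cancel_intProd hm (by rw [h', smul_zero]))

/-- For a nonzero vector, being parallel to it is linear dependence with a nonzero coefficient. -/
theorem exists_smul_eq_of_det_eq_zero {x y : ℤ × ℤ} (hx : x ≠ 0) (h : det x y = 0) :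
    ∃ α β : ℤ, α ≠ 0 ∧ α • y = β • x := by
  unfold det at h
  by_cases h1 : x.1 = 0
  · have h2 : x.2 ≠ 0 := fun h2 => hx (Prod.ext h1 h2)
    refine ⟨x.2, y.2, h2, Prod.ext ?_ ?_⟩ <;> simp <;> linarith
  · refine ⟨x.1, y.1, h1, Prod.ext ?_ ?_⟩ <;> simp <;> linarith

/-- A primitive element of `H` generates the intersection of `H` with its line. -/
theorem IsPrimitiveIn.exists_eq_smul {H : AddSubgroup (ℤ × ℤ)} {x y : ℤ × ℤ}
    (hx : IsPrimitiveIn H x) (hy : y ∈ H) {α β : ℤ} (hα : α ≠ 0) (h : α • y = β • x) :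
    ∃ j : ℤ, y = j • x := by
  obtain ⟨hxH, hx0, hprim⟩ := hx
  have hg : (Int.gcd α β : ℤ) ≠ 0 := by
    simp [Int.gcd_eq_zero_iff, hα]
  obtain ⟨α', hα'⟩ := Int.gcd_dvd_left α β
  obtain ⟨β', hβ'⟩ := Int.gcd_dvd_right α β
  set g : ℤ := (Int.gcd α β : ℤ) with hgdef
  have hrel : α' • y = β' • x := by
    apply smul_left_cancel_intProd hg
    rw [smul_smul, smul_smul, ← hα', ← hβ', h]
  have hbez : α' * Int.gcdA α β + β' * Int.gcdB α β = 1 := by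
    have := Int.gcd_eq_gcd_ab α β
    rw [← hgdef] at this
    apply mul_left_cancel₀ hg
    calc g * (α' * Int.gcdA α β + β' * Int.gcdB α β)
        = (g * α') * Int.gcdA α β + (g * β') * Int.gcdB α β := by ring
      _ = g * 1 := by rw [← hα', ← hβ', ← this, mul_one]
  set s := Int.gcdA α β
  set t := Int.gcdB α β
  have hz : α' • (s • x + t • y) = x := by
    calc α' • (s • x + t • y) = (α' * s) • x + t • (α' • y) := by module
      _ = (α' * s + β' * t) • x := by rw [hrel]; module
      _ = x := by rw [hbez, one_smul]
  rcases hprim α' _ (H.add_mem (H.zsmul_mem hxH s) (H.zsmul_mem hy t)) hz with h1 | h1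
  · exact ⟨β', by rw [← hrel, h1, one_smul]⟩
  · refine ⟨-β', ?_⟩
    rw [neg_smul, ← hrel, h1, neg_one_smul, neg_neg]

theorem IsPrimitiveIn.neg {A : Type*} [AddCommGroup A] {H : AddSubgroup A} {x : A}
    (hx : IsPrimitiveIn H x) : IsPrimitiveIn H (-x) := by
  refine ⟨H.neg_mem hx.1, neg_ne_zero.2 hx.2.1, fun n y hy h => ?_⟩
  exact hx.2.2 n (-y) (H.neg_mem hy) (by rw [smul_neg, h, neg_neg])

/-- To be primitive it suffices not to be a multiple by a prime number. -/
theorem isPrimitiveIn_of_prime {H : AddSubgroup (ℤ × ℤ)} {x : ℤ × ℤ} (hx : x ∈ H) (hx0 : x ≠ 0)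
    (h : ∀ p : ℕ, p.Prime → ∀ y ∈ H, (p : ℤ) • y ≠ x) : IsPrimitiveIn H x := by
  refine ⟨hx, hx0, fun n y hy hny => ?_⟩
  by_contra hn
  push Not at hn
  have hn1 : n.natAbs ≠ 1 := by omega
  obtain ⟨p, hp, m, hm⟩ := Nat.exists_prime_and_dvd hn1
  obtain ⟨m', hm'⟩ : (p : ℤ) ∣ n := Int.natCast_dvd.2 ⟨m, hm⟩
  exact h p hp (m' • y) (H.zsmul_mem hy m') (by rw [smul_smul, ← hm', hny])

/-- Cyclic subgroups of `ℤ²` are separable, with congruence quotients. -/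
theorem exists_separating_modulus {u x : ℤ × ℤ} (hu : u ≠ 0) (hx : x ∉ AddSubgroup.zmultiples u) :
    ∃ N₀ : ℕ, 0 < N₀ ∧ ∀ N : ℕ, N₀ ∣ N → ∀ (m : ℤ) (y : ℤ × ℤ), x ≠ m • u + (N : ℤ) • y := by
  have hx' : ∀ m : ℤ, m • u ≠ x := fun m hm => hx (AddSubgroup.mem_zmultiples_iff.2 ⟨m, hm⟩)
  by_cases hd : det u x = 0
  · -- `x` is parallel to `u`: a nonzero coordinate of `u` is the modulus
    unfold det at hd
    by_cases h1 : u.1 = 0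
    · have h2 : u.2 ≠ 0 := fun h2 => hu (Prod.ext h1 h2)
      refine ⟨u.2.natAbs, Int.natAbs_pos.2 h2, fun N hN m y hxy => ?_⟩
      have e2 := congrArg Prod.snd hxy
      simp only [Prod.snd_add, Prod.smul_snd, smul_eq_mul] at e2
      obtain ⟨c, hc⟩ := Int.natAbs_dvd_natAbs.1 (by simpa using hN : u.2.natAbs ∣ (N : ℤ).natAbs)
      refine hx' (m + c * y.2) (Prod.ext ?_ ?_)
      · rw [h1] at hd
        have : x.1 = 0 := by
          have : u.2 * x.1 = 0 := by linarith
          exact (mul_eq_zero.1 this).resolve_left h2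
        simp [h1, this]
      · simp only [Prod.smul_snd, smul_eq_mul]
        rw [e2, hc]; ring
    · refine ⟨u.1.natAbs, Int.natAbs_pos.2 h1, fun N hN m y hxy => ?_⟩
      have e2 := congrArg Prod.fst hxy
      simp only [Prod.fst_add, Prod.smul_fst, smul_eq_mul] at e2
      obtain ⟨c, hc⟩ := Int.natAbs_dvd_natAbs.1 (by simpa using hN : u.1.natAbs ∣ (N : ℤ).natAbs)
      have e3 : x.1 = (m + c * y.1) * u.1 := by rw [e2, hc]; ring
      refine hx' (m + c * y.1) (Prod.ext ?_ ?_)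
      · simp only [Prod.smul_fst, smul_eq_mul]
        exact e3.symm
      · simp only [Prod.smul_snd, smul_eq_mul]
        apply mul_left_cancel₀ h1
        rw [e3] at hd
        linarith
  · refine ⟨(det u x).natAbs + 1, Nat.succ_pos _, fun N hN m y hxy => hd ?_⟩
    have e : det u x = (N : ℤ) * det u y := by
      conv_lhs => rw [hxy]
      rw [det_add_right, det_smul_right, det_smul_right, det_self]; ring
    have hdvd : (((det u x).natAbs + 1 : ℕ) : ℤ) ∣ det u x :=
      (Int.natCast_dvd_natCast.2 hN).trans ⟨_, e⟩
    exact Int.eq_zero_of_abs_lt_dvd hdvd (by push_cast; simp)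

theorem exists_separating_modulus_zero {x : ℤ × ℤ} (hx : x ≠ 0) :
    ∃ N₀ : ℕ, 0 < N₀ ∧ ∀ N : ℕ, N₀ ∣ N → ∀ y : ℤ × ℤ, x ≠ (N : ℤ) • y := by
  refine ⟨x.1.natAbs + x.2.natAbs + 1, Nat.succ_pos _, fun N hN y hxy => hx ?_⟩
  have h1 := congrArg Prod.fst hxy
  have h2 := congrArg Prod.snd hxy
  simp only [Prod.smul_fst, Prod.smul_snd, smul_eq_mul] at h1 h2
  have hN' := Int.natCast_dvd_natCast.2 hN
  refine Prod.ext ?_ ?_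
  · exact Int.eq_zero_of_abs_lt_dvd (hN'.trans ⟨_, h1⟩) (by push_cast; have := abs_nonneg x.2; linarith)
  · exact Int.eq_zero_of_abs_lt_dvd (hN'.trans ⟨_, h2⟩) (by push_cast; have := abs_nonneg x.1; linarith)

/-- The order of `u` modulo `N L` is `N k` when `k u` is primitive in `L`. -/
theorem IsPrimitiveIn.smul_mem_map_iff {L : AddSubgroup (ℤ × ℤ)} {u : ℤ × ℤ} {k : ℤ}
    (h : IsPrimitiveIn L (k • u)) {N : ℤ} (hN : N ≠ 0) (m : ℤ) :
    m • u ∈ L.map (zsmulAddGroupHom N : ℤ × ℤ →+ ℤ × ℤ) ↔ N * k ∣ m := by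
  have hk : k ≠ 0 := by rintro rfl; exact h.2.1 (zero_smul _ _)
  have hu : u ≠ 0 := by rintro rfl; exact h.2.1 (smul_zero _)
  simp only [AddSubgroup.mem_map, zsmulAddGroupHom_apply]
  constructor
  · rintro ⟨y, hy, hy'⟩
    obtain ⟨j, hj⟩ := h.exists_eq_smul hy (α := k * N) (β := m) (mul_ne_zero hk hN)
      (by rw [mul_smul, hy']; module)
    refine ⟨j, ?_⟩
    have : (m - N * k * j) • u = 0 := by
      rw [sub_smul, ← hy', hj]; module
    by_contra hne
    exact smul_ne_zero_intProd (sub_ne_zero.2 hne) hu this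
  · rintro ⟨j, rfl⟩
    exact ⟨j • k • u, L.zsmul_mem h.1 j, by module⟩

/-- Every subgroup of `ℤ²` lies in a subgroup of finite index in which its primitive elements are
still primitive. -/
theorem exists_finiteIndex_isPrimitiveIn (L : AddSubgroup (ℤ × ℤ)) :
    ∃ L' : AddSubgroup (ℤ × ℤ), (∃ d : ℤ, d ≠ 0 ∧ ∀ y, d • y ∈ L') ∧
      ∀ x, IsPrimitiveIn L x → IsPrimitiveIn L' x := by
  by_cases h2 : ∃ x ∈ L, ∃ y ∈ L, det x y ≠ 0
  · obtain ⟨x, hx, y, hy, hd⟩ := h2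
    refine ⟨L, ⟨det x y, hd, fun z => ?_⟩, fun _ h => h⟩
    rw [det_smul_eq]
    exact L.sub_mem (L.zsmul_mem hx _) (L.zsmul_mem hy _)
  push Not at h2
  by_cases h1 : ∃ g ∈ L, g ≠ 0
  · obtain ⟨g, hg, hg0⟩ := h1
    -- a vector orthogonal to the line of `L` spans a complement
    set g' : ℤ × ℤ := (-g.2, g.1) with hg'
    have hd : det g g' ≠ 0 := by
      intro h
      have : g.1 * g.1 + g.2 * g.2 = 0 := by simpa [det, hg'] using h
      have h1 : g.1 = 0 := by nlinarith [sq_nonneg g.1, sq_nonneg g.2]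
      have h2 : g.2 = 0 := by nlinarith [sq_nonneg g.1, sq_nonneg g.2]
      exact hg0 (Prod.ext h1 h2)
    refine ⟨L ⊔ AddSubgroup.zmultiples g', ⟨det g g', hd, fun z => ?_⟩, fun x hx => ?_⟩
    · rw [det_smul_eq]
      exact AddSubgroup.sub_mem _
        (AddSubgroup.mem_sup_left (L.zsmul_mem hg _))
        (AddSubgroup.mem_sup_right (AddSubgroup.zsmul_mem _ (AddSubgroup.mem_zmultiples _) _))
    · refine ⟨AddSubgroup.mem_sup_left hx.1, hx.2.1, fun n y hy hny => ?_⟩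
      obtain ⟨l, hl, z, hz, rfl⟩ := AddSubgroup.mem_sup.1 hy
      obtain ⟨β, rfl⟩ := AddSubgroup.mem_zmultiples_iff.1 hz
      have hn : n ≠ 0 := by rintro rfl; exact hx.2.1 (by rw [← hny, zero_smul])
      have e : det g (n • (l + β • g')) = n * β * det g g' := by
        rw [det_smul_right, det_add_right, det_smul_right, h2 g hg l hl]; ring
      rw [hny, h2 g hg x hx.1] at e
      have hβ : β = 0 := by
        rcases mul_eq_zero.1 e.symm with h | h
        · exact (mul_eq_zero.1 h).resolve_left hn
        · exact absurd h hd
      subst hβ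
      exact hx.2.2 n l hl (by simpa using hny)
  · push Not at h1
    refine ⟨⊤, ⟨1, one_ne_zero, fun y => AddSubgroup.mem_top _⟩, fun x hx => ?_⟩
    exact absurd (h1 x hx.1) hx.2.1

theorem finite_quotient_of_smul_mem {K : AddSubgroup (ℤ × ℤ)} {d : ℤ} (hd : d ≠ 0)
    (h : ∀ y, d • y ∈ K) : Finite ((ℤ × ℤ) ⧸ K) := by
  have : Module.Finite ℤ ((ℤ × ℤ) ⧸ K) :=
    Module.Finite.of_surjective (QuotientAddGroup.mk' K).toIntLinearMap
      (QuotientAddGroup.mk'_surjective K)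
  apply Module.finite_of_fg_torsion
  intro x
  obtain ⟨y, rfl⟩ := QuotientAddGroup.mk'_surjective K x
  refine ⟨⟨d, mem_nonZeroDivisors_of_ne_zero hd⟩, ?_⟩
  change d • QuotientAddGroup.mk' K y = 0
  rw [← map_zsmul]
  exact (QuotientAddGroup.eq_zero_iff _).2 (h y)

theorem finite_setOf_smul_eq (u : ℤ × ℤ) (hu : u ≠ 0) :
    {z : ℤ × ℤ | ∃ p : ℤ, p • z = u}.Finite := by
  refine (Set.finite_Icc (-|u.1|, -|u.2|) (|u.1|, |u.2|)).subset ?_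
  rintro z ⟨p, rfl⟩
  have hp : 1 ≤ |p| := by
    apply Int.one_le_abs
    rintro rfl
    exact hu (zero_smul _ _)
  have h1 : |z.1| ≤ |p * z.1| := by
    rw [abs_mul]; nlinarith [abs_nonneg z.1]
  have h2 : |z.2| ≤ |p * z.2| := by
    rw [abs_mul]; nlinarith [abs_nonneg z.2]
  rw [abs_le] at h1 h2
  exact ⟨⟨h1.1, h2.1⟩, ⟨h1.2, h2.2⟩⟩

theorem infinite_quotient_zmultiples (u : ℤ × ℤ) :
    Infinite ((ℤ × ℤ) ⧸ AddSubgroup.zmultiples u) := by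
  obtain ⟨y, hy⟩ : ∃ y : ℤ × ℤ, ∀ m : ℤ, m ≠ 0 → m • y ∉ AddSubgroup.zmultiples u := by
    by_cases h : u.1 = 0
    · refine ⟨(1, 0), fun m hm hmem => hm ?_⟩
      obtain ⟨j, hj⟩ := AddSubgroup.mem_zmultiples_iff.1 hmem
      simpa [h] using (congrArg Prod.fst hj).symm
    · refine ⟨(0, 1), fun m hm hmem => hm ?_⟩
      obtain ⟨j, hj⟩ := AddSubgroup.mem_zmultiples_iff.1 hmem
      have h1 : j = 0 := by simpa [h] using congrArg Prod.fst hj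
      simpa [h1] using (congrArg Prod.snd hj).symm
  refine Infinite.of_injective
    (fun m : ℤ => ((m • y : ℤ × ℤ) : (ℤ × ℤ) ⧸ AddSubgroup.zmultiples u)) fun m n hmn => ?_
  rw [QuotientAddGroup.eq, ← neg_smul, ← add_smul] at hmn
  by_contra hne
  exact hy _ (by omega) hmn

theorem IsPrimitiveIn.map_equiv {A B : Type*} [AddCommGroup A] [AddCommGroup B]
    (c : A ≃+ B) {H : AddSubgroup A} {x : A} (h : IsPrimitiveIn H x) :
    IsPrimitiveIn (H.map c.toAddMonoidHom) (c x) := by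
  refine ⟨⟨x, h.1, rfl⟩, by simpa using h.2.1, ?_⟩
  rintro n _ ⟨y, hy, rfl⟩ hn
  exact h.2.2 n y hy (c.injective (by rw [map_zsmul]; exact hn))

theorem isPrimitiveIn_map_equiv_iff {A B : Type*} [AddCommGroup A] [AddCommGroup B]
    (c : A ≃+ B) {H : AddSubgroup A} {x : A} :
    IsPrimitiveIn (H.map c.toAddMonoidHom) (c x) ↔ IsPrimitiveIn H x := by
  refine ⟨fun h => ?_, fun h => h.map_equiv c⟩
  have := h.map_equiv c.symm
  rw [AddSubgroup.map_map] at this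
  have h2 : (c.symm.toAddMonoidHom.comp c.toAddMonoidHom) = AddMonoidHom.id A := by ext; simp
  rwa [h2, AddSubgroup.map_id, AddEquiv.symm_apply_apply] at this

/-- A system of vectors `w (e, b)`, grouped in pairs, is regulated by `k` if all the vectors
`k e • w (e, b)` are primitive in the subgroup that they generate. -/
def IsRegulated {E : Type*} (w : E × Bool → ℤ × ℤ) (k : E → ℤ) : Prop :=
  ∀ x, IsPrimitiveIn (AddSubgroup.closure (Set.range fun x : E × Bool => k x.1 • w x))
    (k x.1 • w x)


/-! ### Reduced words acting by permutations -/

theorem exists_section_through {X Θ J : Type*} (r : X → Θ) (hr : Function.Surjective r)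
    (pt : J → X) (hpt : Function.Injective (r ∘ pt)) :
    ∃ s : Θ → X, (∀ c, r (s c) = c) ∧ ∀ j, s (r (pt j)) = pt j := by
  classical
  refine ⟨fun c => if h : ∃ j, r (pt j) = c then pt h.choose else Function.surjInv hr c,
    fun c => ?_, fun j => ?_⟩
  · dsimp only
    split_ifs with h
    · exact h.choose_spec
    · exact Function.surjInv_eq hr c
  · have h : ∃ j', r (pt j') = r (pt j) := ⟨j, rfl⟩
    dsimp only
    rw [dif_pos h, hpt h.choose_spec]

open Equiv in
/-- Two permutations all of whose orbits are alike, with equally many orbits, are conjugate, and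
the conjugating permutation may be prescribed at finitely many points lying in distinct orbits.
The maps `q` and `q'` are the projections to the sets of orbits. -/
theorem exists_perm_conj {X Ω Ω' : Type*} {J : Type*} [Finite J] (π ρ : Perm X) (q : X → Ω)
    (q' : X → Ω') (hq : ∀ x y, q x = q y ↔ ∃ m : ℤ, (π ^ m) x = y)
    (hq' : ∀ x y, q' x = q' y ↔ ∃ m : ℤ, (ρ ^ m) x = y)
    (sq : Function.Surjective q) (sq' : Function.Surjective q')
    (hord : ∀ (m : ℤ) (x y : X), (π ^ m) x = x ↔ (ρ ^ m) y = y)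
    (hΩ : Nonempty (Ω ≃ Ω')) (src tgt : J → X)
    (hsrc : Function.Injective (q ∘ src)) (htgt : Function.Injective (q' ∘ tgt)) :
    ∃ τ : Perm X, τ * π * τ⁻¹ = ρ ∧ ∀ j, τ (src j) = tgt j := by
  classical
  -- extend the matching of the prescribed orbits to a matching `σ` of all orbits
  obtain ⟨σ, hσ⟩ : ∃ σ : Ω ≃ Ω', ∀ j, σ (q (src j)) = q' (tgt j) := by
    let f : Set.range (q ∘ src) ↪ Ω' :=
      ⟨fun c => q' (tgt ((Equiv.ofInjective _ hsrc).symm c)), fun a b hab => by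
        exact (Equiv.ofInjective _ hsrc).symm.injective (htgt hab)⟩
    obtain ⟨σ, hσ⟩ : ∃ σ : Ω ≃ Ω', ∀ c : Set.range (q ∘ src), σ c = f c := by
      rcases finite_or_infinite Ω with hfin | hinf
      · exact Cardinal.extend_function_finite f hΩ
      · refine Cardinal.extend_function_of_lt f ?_ hΩ
        exact lt_of_lt_of_le (Cardinal.lt_aleph0_iff_finite.2 inferInstance)
          (Cardinal.aleph0_le_mk Ω)
    refine ⟨σ, fun j => ?_⟩
    have := hσ ⟨q (src j), j, rfl⟩
    rw [this]
    change q' (tgt ((Equiv.ofInjective _ hsrc).symm ⟨(q ∘ src) j, j, rfl⟩)) = _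
    rw [Equiv.ofInjective_symm_apply]
  -- orbit representatives adapted to the prescribed points
  obtain ⟨s, hs, hsj⟩ := exists_section_through q sq src hsrc
  obtain ⟨s', hs', hsj'⟩ := exists_section_through q' sq' tgt htgt
  have hm : ∀ x, ∃ m : ℤ, (π ^ m) (s (q x)) = x := fun x => (hq _ _).1 (hs _)
  choose m hm using hm
  have hfix : ∀ (a b : ℤ) (x y : X), (π ^ a) x = (π ^ b) x ↔ (ρ ^ a) y = (ρ ^ b) y := by
    intro a b x y
    have h := hord (-b + a) x y
    rw [zpow_add, zpow_add, Perm.mul_apply, Perm.mul_apply, zpow_neg, zpow_neg,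
      Perm.inv_eq_iff_eq, Perm.inv_eq_iff_eq] at h
    exact h.trans Iff.rfl
  set t : X → X := fun x => (ρ ^ m x) (s' (σ (q x))) with ht
  have hqt : ∀ x, q' (t x) = σ (q x) := by
    intro x
    have := (hq' (s' (σ (q x))) (t x)).2 ⟨m x, rfl⟩
    rw [← this, hs']
  have hinj : Function.Injective t := by
    intro x y hxy
    have h1 : q x = q y := by
      apply σ.injective
      rw [← hqt, ← hqt, hxy]
    have h2 : (ρ ^ m x) (s' (σ (q x))) = (ρ ^ m y) (s' (σ (q x))) := by
      conv_rhs => rw [h1]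
      exact hxy
    have h3 := (hfix _ _ (s (q x)) _).2 h2
    rw [hm] at h3
    rw [h3, h1, hm]
  have ht_of : ∀ (x : X) (a : ℤ), (π ^ a) (s (q x)) = x → t x = (ρ ^ a) (s' (σ (q x))) := by
    intro x a ha
    refine (hfix _ _ (s (q x)) _).1 ?_
    rw [hm, ha]
  have hsurj : Function.Surjective t := by
    intro y
    obtain ⟨a, ha⟩ := (hq' (s' (q' y)) y).1 (hs' _)
    have hqx : q ((π ^ a) (s (σ.symm (q' y)))) = σ.symm (q' y) := by
      rw [← (hq (s (σ.symm (q' y))) _).2 ⟨a, rfl⟩, hs]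
    refine ⟨(π ^ a) (s (σ.symm (q' y))), ?_⟩
    rw [ht_of _ a (by rw [hqx]), hqx, Equiv.apply_symm_apply, ha]
  refine ⟨Equiv.ofBijective t ⟨hinj, hsurj⟩, ?_, fun j => ?_⟩
  · rw [mul_inv_eq_iff_eq_mul]
    ext x
    change t (π x) = ρ (t x)
    have hqx : q (π x) = q x := ((hq x (π x)).2 ⟨1, by simp⟩).symm
    rw [ht_of (π x) (1 + m x) (by rw [hqx, zpow_add, Perm.mul_apply, hm, zpow_one]), hqx, zpow_add,
      Perm.mul_apply, zpow_one]
  · change t (src j) = tgt j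
    rw [ht_of (src j) 0 (by rw [hsj]; rfl), hσ, hsj']
    rfl

/-- The action of an additive group on copies of itself indexed by `F`, by left translations. -/
def translation (B F : Type*) [AddGroup B] : Multiplicative B →* Equiv.Perm (B × F) where
  toFun a := (Equiv.addLeft a.toAdd).prodCongr (Equiv.refl F)
  map_one' := by ext <;> simp
  map_mul' a b := by ext <;> simp [add_assoc]

theorem translation_apply {B F : Type*} [AddGroup B] (a b : B) (i : F) :
    translation B F (Multiplicative.ofAdd a) (b, i) = (a + b, i) := rfl

section Words

variable {E B : Type*} [AddCommGroup B]

/-- The product `t₁ a₁ t₂ a₂ ⋯` in a group `P`, where the letter `(e, b, a)` stands for the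
stable letter `τ e`, inverted if `b` is `false`, followed by the base element `a`. -/
def wordEval {P : Type*} [Group P] (α : Multiplicative B →* P) (τ : E → P) :
    List (E × Bool × B) → P
  | [] => 1
  | x :: l => (if x.2.1 then τ x.1 else (τ x.1)⁻¹) * α (Multiplicative.ofAdd x.2.2) *
      wordEval α τ l

/-- A word is reduced if it has no subword `t a t⁻¹` or `t⁻¹ a t` with `a` in the associated
subgroup. The stable letter `t_e` conjugates `w (e, true)` to `w (e, false)`. -/
def IsReducedWord (w : E × Bool → B) (l : List (E × Bool × B)) : Prop :=
  l.IsChain fun x y =>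
    ¬ (x.1 = y.1 ∧ y.2.1 = !x.2.1 ∧ x.2.2 ∈ AddSubgroup.zmultiples (w (x.1, x.2.1)))

/-- Reduced words act nontrivially: for a reduced word `l` of length `n`, a base group `B` acting
on `n + 1` copies of itself by translations, the stable letters can be made to act in such a way
that `l` sends the base point of the last copy to the base point of the first one. -/
theorem exists_perm_wordEval (w : E × Bool → B)
    (hord : ∀ (e : E) (m : ℤ), m • w (e, true) = 0 ↔ m • w (e, false) = 0)
    (hcard : ∀ e, Nonempty ((B ⧸ AddSubgroup.zmultiples (w (e, true))) ≃
      (B ⧸ AddSubgroup.zmultiples (w (e, false)))))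
    (l : List (E × Bool × B)) (hl : IsReducedWord w l) :
    ∃ τ : E → Equiv.Perm (B × Fin (l.length + 1)),
      (∀ e, τ e * translation B _ (Multiplicative.ofAdd (w (e, true))) * (τ e)⁻¹ =
        translation B _ (Multiplicative.ofAdd (w (e, false)))) ∧
      wordEval (translation B _) τ l (0, Fin.last _) = (0, 0) := by
  classical
  have hzpow : ∀ (a : B) (m : ℤ) (x : B × Fin (l.length + 1)),
      (translation B (Fin (l.length + 1)) (Multiplicative.ofAdd a) ^ m) x = (m • a + x.1, x.2) := by
    intro a m x
    rw [← map_zpow, ← ofAdd_zsmul]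
    rfl
  have hproj : ∀ (a : B) (x y : B × Fin (l.length + 1)),
      ((x.1 : B ⧸ AddSubgroup.zmultiples a), x.2) = ((y.1 : B ⧸ AddSubgroup.zmultiples a), y.2) ↔
      ∃ m : ℤ, (translation B (Fin (l.length + 1)) (Multiplicative.ofAdd a) ^ m) x = y := by
    intro a x y
    simp only [hzpow, Prod.ext_iff, QuotientAddGroup.eq, AddSubgroup.mem_zmultiples_iff,
      exists_and_right]
    refine and_congr_left fun _ => exists_congr fun m => ?_
    rw [eq_neg_add_iff_add_eq, add_comm]
  have hsurj : ∀ a : B, Function.Surjective fun x : B × Fin (l.length + 1) =>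
      ((x.1 : B ⧸ AddSubgroup.zmultiples a), x.2) := by
    rintro a ⟨c, i⟩
    obtain ⟨b, rfl⟩ := QuotientAddGroup.mk_surjective c
    exact ⟨(b, i), rfl⟩
  -- the letter number `i` has to send the point `hi i` of copy `i + 1` to the base point of copy `i`
  let hi : Fin l.length → B × Fin (l.length + 1) := fun i => ((l.get i).2.2, i.succ)
  let lo : Fin l.length → B × Fin (l.length + 1) := fun i => (0, i.castSucc)
  -- prescribed values of `t_e` (for `b = true`) or of its inverse (for `b = false`) at distinct
  -- letters lie in distinct orbits, because the word is reduced
  have hinj : ∀ (e : E) (b : Bool), Function.Injective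
      fun i : {i : Fin l.length // (l.get i).1 = e} =>
        (fun x : B × Fin (l.length + 1) =>
          ((x.1 : B ⧸ AddSubgroup.zmultiples (w (e, b))), x.2))
        (if (l.get i).2.1 = b then hi i else lo i) := by
    intro e b
    have hlt : ∀ i j : Fin l.length, i < j → (l.get i).1 = e → (l.get j).1 = e →
        (fun x : B × Fin (l.length + 1) =>
          ((x.1 : B ⧸ AddSubgroup.zmultiples (w (e, b))), x.2))
        (if (l.get i).2.1 = b then hi i else lo i) ≠
        (fun x : B × Fin (l.length + 1) =>
          ((x.1 : B ⧸ AddSubgroup.zmultiples (w (e, b))), x.2))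
        (if (l.get j).2.1 = b then hi j else lo j) := by
      intro i j hij hei hej heq
      obtain ⟨i, hi'⟩ := i
      obtain ⟨j, hj'⟩ := j
      rw [Fin.mk_lt_mk] at hij
      simp only [Prod.mk.injEq] at heq
      obtain ⟨h1, h2⟩ := heq
      split_ifs at h1 h2 with c1 c2 c2
      · simp only [hi, Fin.succ_mk, Fin.mk.injEq] at h2; omega
      · simp only [hi, lo, Fin.succ_mk, Fin.castSucc_mk, Fin.mk.injEq] at h2
        subst h2
        have hch := List.isChain_iff_getElem.1 hl i hj'
        refine hch ⟨hei.trans hej.symm, ?_, ?_⟩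
        · simp only [List.get_eq_getElem] at c1 c2
          rw [c1]
          exact Bool.eq_not.2 c2
        · simp only [List.get_eq_getElem] at c1 hei
          rw [c1, hei]
          have h3 := h1.symm
          simp only [hi, lo, List.get_eq_getElem] at h3
          rw [QuotientAddGroup.eq] at h3
          simpa using h3
      · simp only [hi, lo, Fin.succ_mk, Fin.castSucc_mk, Fin.mk.injEq] at h2; omega
      · simp only [lo, Fin.castSucc_mk, Fin.mk.injEq] at h2; omega
    rintro ⟨i, hie⟩ ⟨j, hje⟩ heq
    rcases lt_trichotomy i j with h | h | h
    · exact absurd heq (hlt i j h hie hje)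
    · exact Subtype.ext h
    · exact absurd heq.symm (hlt j i h hje hie)
  have hex : ∀ e : E, ∃ τ : Equiv.Perm (B × Fin (l.length + 1)),
      τ * translation B _ (Multiplicative.ofAdd (w (e, true))) * τ⁻¹ =
        translation B _ (Multiplicative.ofAdd (w (e, false))) ∧
      ∀ i : {i : Fin l.length // (l.get i).1 = e},
        τ (if (l.get i).2.1 = true then hi i else lo i) =
          if (l.get i).2.1 = false then hi i else lo i := by
    intro e
    obtain ⟨eqv⟩ := hcard e
    refine exists_perm_conj _ _ _ _ (hproj (w (e, true))) (hproj (w (e, false)))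
      (hsurj _) (hsurj _) ?_ ⟨eqv.prodCongr (Equiv.refl _)⟩ _ _ (hinj e true) (hinj e false)
    intro m x y
    simp only [hzpow, Prod.ext_iff, and_true, add_eq_right, hord]
  choose τ hτ hτi using hex
  refine ⟨τ, hτ, ?_⟩
  have hletter : ∀ i : Fin l.length,
      (if (l.get i).2.1 then τ (l.get i).1 else (τ (l.get i).1)⁻¹) (hi i) = lo i := by
    intro i
    have := hτi _ ⟨i, rfl⟩
    rcases hb : (l.get i).2.1 with _ | _
    · simp only [hb] at this ⊢
      rw [if_neg (by simp), Equiv.Perm.inv_eq_iff_eq]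
      simpa using this.symm
    · simp only [hb] at this ⊢
      simpa using this
  have hdrop : ∀ (s : List (E × Bool × B)) (i : ℕ) (hil : i ≤ l.length), l.drop i = s →
      wordEval (translation B (Fin (l.length + 1))) τ s (0, Fin.last _) =
        (0, ⟨i, Nat.lt_succ_of_le hil⟩) := by
    intro s
    induction s with
    | nil =>
      intro i hil h
      have : i = l.length := le_antisymm hil (List.drop_eq_nil_iff.1 h)
      subst this
      rfl
    | cons x s ih =>
      intro i hil h
      have hlt : i < l.length := by
        by_contra hge
        rw [List.drop_eq_nil_of_le (not_lt.1 hge)] at h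
        exact List.cons_ne_nil _ _ h.symm
      rw [List.drop_eq_getElem_cons hlt, List.cons.injEq] at h
      obtain ⟨rfl, h⟩ := h
      rw [wordEval, Equiv.Perm.mul_apply, Equiv.Perm.mul_apply, ih (i + 1) hlt h,
        translation_apply, add_zero]
      exact hletter ⟨i, hlt⟩
  exact hdrop l 0 (Nat.zero_le _) rfl

end Words

section WordEval

variable {E B C : Type*} [AddCommGroup B] [AddCommGroup C] {P Q : Type*} [Group P] [Group Q]

theorem map_wordEval (φ : P →* Q) (α : Multiplicative B →* P) (τ : E → P)
    (l : List (E × Bool × B)) :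
    φ (wordEval α τ l) = wordEval (φ.comp α) (fun e => φ (τ e)) l := by
  induction l with
  | nil => simp [wordEval]
  | cons x l ih =>
    rw [wordEval, wordEval, map_mul, map_mul, ih]
    split_ifs <;> simp

theorem wordEval_comp (f : B →+ C) (α : Multiplicative C →* P) (τ : E → P)
    (l : List (E × Bool × B)) :
    wordEval (α.comp f.toMultiplicative) τ l =
      wordEval α τ (l.map fun x => (x.1, x.2.1, f x.2.2)) := by
  induction l with
  | nil => rfl
  | cons x l ih =>
    rw [List.map_cons, wordEval, wordEval, ih]
    rfl

/-- A stable letter moves across a multiple of a generator of its associated subgroup. -/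
theorem stable_mul_zsmul {α : Multiplicative B →* P} {τ : E → P} {w : E × Bool → B}
    (h : ∀ e, τ e * α (Multiplicative.ofAdd (w (e, true))) * (τ e)⁻¹ =
      α (Multiplicative.ofAdd (w (e, false)))) (e : E) (b : Bool) (m : ℤ) :
    (if b then τ e else (τ e)⁻¹) * α (Multiplicative.ofAdd (m • w (e, b))) *
        (if (!b) then τ e else (τ e)⁻¹) =
      α (Multiplicative.ofAdd (m • w (e, !b))) := by
  simp only [ofAdd_zsmul, map_zpow]
  cases b
  · simp only [Bool.false_eq_true, if_false, Bool.not_false, if_true, ← h e, conj_zpow]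
    group
  · simp only [if_true, Bool.not_true, Bool.false_eq_true, if_false, ← h e, conj_zpow]

end WordEval

/-! ### Reduced words in tubular groups -/

namespace OneVertexTubular

variable {T : OneVertexTubular.{u, v, w}}

/-- The coordinates of the images of the generator of the edge group of `e` under the two attaching
maps, the initial one being indexed by `(e, true)`. -/
def endVector (c : T.Vert ≃+ ℤ × ℤ) (g : ∀ e, ℤ ≃+ T.Edge e) (x : T.E × Bool) : ℤ × ℤ :=
  c (if x.2 then T.neg x.1 (g x.1 1) else T.pos x.1 (g x.1 1))

/-- The vertex group, in coordinates, mapped to the tubular group. -/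
def baseHom (c : T.Vert ≃+ ℤ × ℤ) : Multiplicative (ℤ × ℤ) →* T.TubularGroup :=
  ((QuotientGroup.mk' _).comp Monoid.Coprod.inl).comp c.symm.toAddMonoidHom.toMultiplicative

/-- The stable letter of an edge in the tubular group. -/
def stable (e : T.E) : T.TubularGroup :=
  QuotientGroup.mk' _ (Monoid.Coprod.inr (FreeGroup.of e))

theorem endVector_ne_zero (c : T.Vert ≃+ ℤ × ℤ) (g : ∀ e, ℤ ≃+ T.Edge e) (x : T.E × Bool) :
    endVector c g x ≠ 0 := by
  have h1 : g x.1 1 ≠ 0 := by simp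
  unfold endVector
  split_ifs
  · simpa using fun h => h1 (T.neg_injective x.1 (by rw [h, map_zero]))
  · simpa using fun h => h1 (T.pos_injective x.1 (by rw [h, map_zero]))

theorem stable_conj (c : T.Vert ≃+ ℤ × ℤ) (g : ∀ e, ℤ ≃+ T.Edge e) (e : T.E) :
    stable e * baseHom c (Multiplicative.ofAdd (endVector c g (e, true))) * (stable e)⁻¹ =
      baseHom c (Multiplicative.ofAdd (endVector c g (e, false))) := by
  rw [← mul_inv_eq_one]
  have h : Monoid.Coprod.inr (FreeGroup.of e) *
        Monoid.Coprod.inl (Multiplicative.ofAdd (T.neg e (g e 1))) *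
        (Monoid.Coprod.inr (FreeGroup.of e))⁻¹ *
        (Monoid.Coprod.inl (Multiplicative.ofAdd (T.pos e (g e 1))))⁻¹ ∈
      Subgroup.normalClosure T.relators := Subgroup.subset_normalClosure ⟨e, g e 1, rfl⟩
  rw [← QuotientGroup.eq_one_iff] at h
  have e1 : c.symm (endVector c g (e, true)) = T.neg e (g e 1) := by simp [endVector]
  have e2 : c.symm (endVector c g (e, false)) = T.pos e (g e 1) := by simp [endVector]
  rw [← e1, ← e2] at h
  exact h

/-- The universal property of the tubular group, for the relations given by the generators of the
edge groups. -/
theorem exists_lift (c : T.Vert ≃+ ℤ × ℤ) (g : ∀ e, ℤ ≃+ T.Edge e) {P : Type*} [Group P]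
    (α : Multiplicative (ℤ × ℤ) →* P) (τ : T.E → P)
    (h : ∀ e, τ e * α (Multiplicative.ofAdd (endVector c g (e, true))) * (τ e)⁻¹ =
      α (Multiplicative.ofAdd (endVector c g (e, false)))) :
    ∃ Φ : T.TubularGroup →* P, Φ.comp (baseHom c) = α ∧ ∀ e, Φ (stable e) = τ e := by
  let Ψ : Monoid.Coprod (Multiplicative T.Vert) (FreeGroup T.E) →* P :=
    Monoid.Coprod.lift (α.comp c.toAddMonoidHom.toMultiplicative) (FreeGroup.lift τ)
  have hΨl : ∀ a, Ψ (Monoid.Coprod.inl (Multiplicative.ofAdd a)) =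
      α (Multiplicative.ofAdd (c a)) := fun a => by
    simp only [Ψ, Monoid.Coprod.lift_apply_inl]; rfl
  have hΨr : ∀ e, Ψ (Monoid.Coprod.inr (FreeGroup.of e)) = τ e := fun e => by
    simp only [Ψ, Monoid.Coprod.lift_apply_inr, FreeGroup.lift_apply_of]
  have hker : Subgroup.normalClosure T.relators ≤ Ψ.ker := by
    apply Subgroup.normalClosure_le_normal
    rintro _ ⟨e, y, rfl⟩
    obtain ⟨m, rfl⟩ := (g e).surjective y
    have hm : g e m = m • g e 1 := by rw [← map_zsmul, smul_eq_mul, mul_one]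
    have e1 : c (T.neg e (g e m)) = m • endVector c g (e, true) := by
      simp [endVector, hm, map_zsmul]
    have e2 : c (T.pos e (g e m)) = m • endVector c g (e, false) := by
      simp [endVector, hm, map_zsmul]
    change Ψ _ = 1
    rw [map_mul, map_mul, map_mul, map_inv, map_inv, hΨr, hΨl, hΨl, e1, e2, mul_inv_eq_one]
    simpa using stable_mul_zsmul h e true m
  refine ⟨QuotientGroup.lift _ Ψ hker, ?_, fun e => ?_⟩
  · ext a
    · change Ψ (Monoid.Coprod.inl (Multiplicative.ofAdd (c.symm _))) = _
      rw [hΨl, AddEquiv.apply_symm_apply]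
      rfl
  · exact hΨr e

/-- Every element of the tubular group is represented by a reduced word. -/
theorem exists_reducedWord (c : T.Vert ≃+ ℤ × ℤ) (g : ∀ e, ℤ ≃+ T.Edge e) (γ : T.TubularGroup) :
    ∃ (a : ℤ × ℤ) (l : List (T.E × Bool × ℤ × ℤ)), IsReducedWord (endVector c g) l ∧
      γ = baseHom c (Multiplicative.ofAdd a) * wordEval (baseHom c) stable l := by
  classical
  -- the elements whose left multiplication preserves being represented by a reduced word
  let S : Submonoid T.TubularGroup :=
    { carrier := {h | ∀ a l, IsReducedWord (endVector c g) l → ∃ a' l',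
        IsReducedWord (endVector c g) l' ∧
        h * (baseHom c (Multiplicative.ofAdd a) * wordEval (baseHom c) stable l) =
          baseHom c (Multiplicative.ofAdd a') * wordEval (baseHom c) stable l'}
      one_mem' := fun a l hl => ⟨a, l, hl, one_mul _⟩
      mul_mem' := by
        intro x y hx hy a l hl
        obtain ⟨a', l', hl', h'⟩ := hy a l hl
        obtain ⟨a'', l'', hl'', h''⟩ := hx a' l' hl'
        exact ⟨a'', l'', hl'', by rw [mul_assoc, h', h'']⟩ }
  have hbase : ∀ a, baseHom c (Multiplicative.ofAdd a) ∈ S := fun a a' l hl =>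
    ⟨a + a', l, hl, by rw [ofAdd_add, map_mul, mul_assoc]⟩
  have hletter : ∀ (e : T.E) (b : Bool), (if b then stable e else (stable e)⁻¹) ∈ S := by
    intro e b a l hl
    by_cases hp : ∃ y l', l = y :: l' ∧ e = y.1 ∧ y.2.1 = !b ∧
        a ∈ AddSubgroup.zmultiples (endVector c g (e, b))
    · obtain ⟨y, l', rfl, rfl, hb, ha⟩ := hp
      obtain ⟨m, rfl⟩ := AddSubgroup.mem_zmultiples_iff.1 ha
      refine ⟨m • endVector c g (y.1, !b) + y.2.2, l', hl.tail, ?_⟩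
      rw [wordEval, hb, ofAdd_add, map_mul, ← stable_mul_zsmul (stable_conj c g)]
      simp only [mul_assoc]
    · refine ⟨0, (e, b, a) :: l, ?_, ?_⟩
      · unfold IsReducedWord
        rw [List.isChain_cons]
        refine ⟨fun y hy h => hp ?_, hl⟩
        obtain ⟨l', rfl⟩ : ∃ l', l = y :: l' := by
          cases l with
          | nil => simp at hy
          | cons z l' => exact ⟨l', by simpa using hy⟩
        exact ⟨y, l', rfl, h⟩
      · rw [wordEval, ofAdd_zero, map_one, one_mul, mul_assoc]
  have hall : ∀ x : Monoid.Coprod (Multiplicative T.Vert) (FreeGroup T.E),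
      (QuotientGroup.mk' _ x : T.TubularGroup) ∈ S := by
    intro x
    induction x using Monoid.Coprod.induction_on with
    | inl a =>
      have := hbase (c a.toAdd)
      unfold baseHom at this
      simpa using this
    | inr a =>
      induction a using FreeGroup.induction_on with
      | C1 => rw [map_one, map_one]; exact S.one_mem
      | of e => exact hletter e true
      | inv_of e _ => rw [map_inv, map_inv]; exact hletter e false
      | mul x y hx hy => rw [map_mul, map_mul]; exact S.mul_mem hx hy
    | mul x y hx hy => rw [map_mul]; exact S.mul_mem hx hy
  obtain ⟨x, rfl⟩ := QuotientGroup.mk'_surjective _ γ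
  obtain ⟨a, l, hl, h⟩ := hall x 0 [] List.IsChain.nil
  refine ⟨a, l, hl, ?_⟩
  rw [← h]
  simp [wordEval]

/-- If the vertex group maps to `B` so that the two generators attached to each edge have the same
order and equally many cosets, then a product of a base element and a reduced word whose image in
`B` is still reduced acts on finitely many copies of `B`, nontrivially unless the word is empty and
the base element maps to zero. -/
theorem exists_hom_perm (c : T.Vert ≃+ ℤ × ℤ) (g : ∀ e, ℤ ≃+ T.Edge e) {B : Type*}
    [AddCommGroup B] (f : ℤ × ℤ →+ B)
    (hord : ∀ (e : T.E) (m : ℤ),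
      m • f (endVector c g (e, true)) = 0 ↔ m • f (endVector c g (e, false)) = 0)
    (hcard : ∀ e, Nonempty ((B ⧸ AddSubgroup.zmultiples (f (endVector c g (e, true)))) ≃
      (B ⧸ AddSubgroup.zmultiples (f (endVector c g (e, false))))))
    (a : ℤ × ℤ) (l : List (T.E × Bool × ℤ × ℤ))
    (hl : IsReducedWord (fun x => f (endVector c g x)) (l.map fun x => (x.1, x.2.1, f x.2.2)))
    (hne : l = [] → f a ≠ 0) :
    ∃ (n : ℕ) (Φ : T.TubularGroup →* Equiv.Perm (B × Fin n)),
      Φ (baseHom c (Multiplicative.ofAdd a) * wordEval (baseHom c) stable l) ≠ 1 := by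
  obtain ⟨τ, hτ, hw⟩ := exists_perm_wordEval (fun x => f (endVector c g x)) hord hcard _ hl
  generalize hn : (l.map fun x => (x.1, x.2.1, f x.2.2)).length = n at τ hτ hw
  obtain ⟨Φ, hΦ, hΦτ⟩ := exists_lift c g ((translation B (Fin (n + 1))).comp f.toMultiplicative) τ
    (fun e => hτ e)
  refine ⟨_, Φ, fun h => ?_⟩
  rw [map_mul, map_wordEval, hΦ, funext hΦτ, wordEval_comp] at h
  have h1 := DFunLike.congr_fun h (0, Fin.last _)
  rw [Equiv.Perm.mul_apply, hw] at h1
  have h2 : Φ (baseHom c (Multiplicative.ofAdd a)) = translation B _ (Multiplicative.ofAdd (f a)) :=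
    DFunLike.congr_fun hΦ _
  rw [h2, translation_apply, add_zero, Equiv.Perm.one_apply, Prod.mk.injEq] at h1
  cases l with
  | nil => exact hne rfl h1.1
  | cons x l =>
    have := congrArg Fin.val h1.2
    rw [List.map_cons, List.length_cons] at hn
    simp [← hn] at this

/-! ### From regulating tuples to residual finiteness -/

/-- A regulating tuple makes the group residually finite: the quotients of the vertex group by
multiples of the lattice of the tuple extend to virtually free quotients of the tubular group, in
which a given reduced word stays reduced. -/
theorem residuallyFinite_of_isRegulated (c : T.Vert ≃+ ℤ × ℤ) (g : ∀ e, ℤ ≃+ T.Edge e)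
    {k : T.E → ℤ} (hk : IsRegulated (endVector c g) k) : Group.ResiduallyFinite T.TubularGroup := by
  classical
  rw [Group.residuallyFinite_iff_exists_finiteIndex]
  intro γ hγ
  obtain ⟨a, l, hl, rfl⟩ := exists_reducedWord c g γ
  obtain ⟨L, ⟨d, hd, hdL⟩, hL⟩ := exists_finiteIndex_isPrimitiveIn
    (AddSubgroup.closure (Set.range fun x : T.E × Bool => k x.1 • endVector c g x))
  -- a modulus that keeps the word reduced
  have hsep : ∀ x : T.E × Bool × ℤ × ℤ, ∃ N₀ : ℕ, 0 < N₀ ∧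
      (x.2.2 ∉ AddSubgroup.zmultiples (endVector c g (x.1, x.2.1)) → ∀ N : ℕ, N₀ ∣ N →
        ∀ (m : ℤ) (y : ℤ × ℤ), x.2.2 ≠ m • endVector c g (x.1, x.2.1) + (N : ℤ) • y) := by
    intro x
    by_cases hx : x.2.2 ∈ AddSubgroup.zmultiples (endVector c g (x.1, x.2.1))
    · exact ⟨1, one_pos, fun h => absurd hx h⟩
    · obtain ⟨N₀, h0, h⟩ := exists_separating_modulus (endVector_ne_zero c g _) hx
      exact ⟨N₀, h0, fun _ => h⟩
  have hsep0 : ∃ N₀ : ℕ, 0 < N₀ ∧ (a ≠ 0 → ∀ N : ℕ, N₀ ∣ N → ∀ y : ℤ × ℤ, a ≠ (N : ℤ) • y) := by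
    by_cases ha : a = 0
    · exact ⟨1, one_pos, fun h => absurd ha h⟩
    · obtain ⟨N₀, h0, h⟩ := exists_separating_modulus_zero ha
      exact ⟨N₀, h0, fun _ => h⟩
  choose M hM0 hM using hsep
  obtain ⟨N₀, hN₀, hN₀'⟩ := hsep0
  set N : ℕ := N₀ * (l.map M).prod with hN
  have hNpos : N ≠ 0 := by
    refine mul_ne_zero hN₀.ne' fun h => ?_
    obtain ⟨x, -, hx⟩ := List.mem_map.1 (List.prod_eq_zero_iff.1 h)
    exact (hM0 x).ne' hx
  have hNZ : (N : ℤ) ≠ 0 := Nat.cast_ne_zero.2 hNpos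
  set K : AddSubgroup (ℤ × ℤ) := L.map (zsmulAddGroupHom (N : ℤ) : ℤ × ℤ →+ ℤ × ℤ) with hK
  have hKmem : ∀ y ∈ K, ∃ z, y = (N : ℤ) • z := by
    rintro _ ⟨z, -, rfl⟩
    exact ⟨z, rfl⟩
  have hfin : Finite ((ℤ × ℤ) ⧸ K) := by
    refine finite_quotient_of_smul_mem (mul_ne_zero hNZ hd) fun y => ⟨d • y, hdL y, ?_⟩
    change (N : ℤ) • d • y = _
    rw [smul_smul]
  have hord : ∀ (x : T.E × Bool) (m : ℤ),
      m • QuotientAddGroup.mk' K (endVector c g x) = 0 ↔ (N : ℤ) * k x.1 ∣ m := by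
    intro x m
    rw [← map_zsmul, ← (hL _ (hk x)).smul_mem_map_iff hNZ m]
    exact QuotientAddGroup.eq_zero_iff _
  have hord' : ∀ (e : T.E) (m : ℤ), m • QuotientAddGroup.mk' K (endVector c g (e, true)) = 0 ↔
      m • QuotientAddGroup.mk' K (endVector c g (e, false)) = 0 := fun e m => by
    rw [hord, hord]
  suffices h : ∃ (n : ℕ) (Φ : T.TubularGroup →* Equiv.Perm (((ℤ × ℤ) ⧸ K) × Fin n)),
      Φ (baseHom c (Multiplicative.ofAdd a) * wordEval (baseHom c) stable l) ≠ 1 by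
    obtain ⟨n, Φ, hΦ⟩ := h
    have : Finite (Equiv.Perm (((ℤ × ℤ) ⧸ K) × Fin n)) := inferInstance
    exact ⟨Φ.ker, Subgroup.finiteIndex_ker Φ, hΦ⟩
  refine exists_hom_perm c g (QuotientAddGroup.mk' K) hord' ?_ a l ?_ ?_
  · intro e
    have hcard : Nat.card (AddSubgroup.zmultiples (QuotientAddGroup.mk' K (endVector c g (e, true))))
        = Nat.card (AddSubgroup.zmultiples
          (QuotientAddGroup.mk' K (endVector c g (e, false)))) := by
      rw [Nat.card_zmultiples, Nat.card_zmultiples, addOrderOf_eq_addOrderOf_iff]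
      intro m
      have := hord' e m
      rwa [natCast_zsmul, natCast_zsmul] at this
    have h1 := AddSubgroup.card_eq_card_quotient_mul_card_addSubgroup
      (AddSubgroup.zmultiples (QuotientAddGroup.mk' K (endVector c g (e, true))))
    rw [AddSubgroup.card_eq_card_quotient_mul_card_addSubgroup
      (AddSubgroup.zmultiples (QuotientAddGroup.mk' K (endVector c g (e, false)))), ← hcard] at h1
    exact Finite.card_eq.1 (Nat.eq_of_mul_eq_mul_right Nat.card_pos h1).symm
  · unfold IsReducedWord
    rw [List.isChain_map]
    refine List.IsChain.imp_of_mem_imp ?_ hl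
    rintro x y hx - hxy ⟨h1, h2, h3⟩
    refine hxy ⟨h1, h2, ?_⟩
    by_contra hnot
    obtain ⟨m, hm⟩ := AddSubgroup.mem_zmultiples_iff.1 h3
    have hmem : -(m • endVector c g (x.1, x.2.1)) + x.2.2 ∈ K := by
      rw [← QuotientAddGroup.eq]
      exact hm
    obtain ⟨z, hz⟩ := hKmem _ hmem
    refine hM x hnot N ?_ m z ?_
    · exact (List.dvd_prod (List.mem_map_of_mem hx)).trans (Dvd.intro_left _ rfl)
    · rw [← hz]; abel
  · rintro rfl h
    have ha : a ≠ 0 := by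
      rintro rfl
      exact hγ (by simp [wordEval])
    obtain ⟨z, hz⟩ := hKmem a ((QuotientAddGroup.eq_zero_iff _).1 h)
    exact hN₀' ha N (Dvd.intro _ rfl) z hz

/-! ### From residual finiteness to regulating tuples -/

/-- A case of Britton's lemma. -/
theorem conj_commutator_ne_one (c : T.Vert ≃+ ℤ × ℤ) (g : ∀ e, ℤ ≃+ T.Edge e) (e : T.E) (b : Bool)
    {z y : ℤ × ℤ} (hz : z ∉ AddSubgroup.zmultiples (endVector c g (e, b)))
    (hy : y ∉ AddSubgroup.zmultiples (endVector c g (e, !b))) :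
    wordEval (baseHom c) stable [(e, b, z), (e, !b, y), (e, b, -z), (e, !b, -y)] ≠ 1 := by
  intro h
  have hw := endVector_ne_zero c g
  suffices h' : ∃ (n : ℕ) (Φ : T.TubularGroup →* Equiv.Perm ((ℤ × ℤ) × Fin n)),
      Φ (baseHom c (Multiplicative.ofAdd 0) * wordEval (baseHom c) stable
        [(e, b, z), (e, !b, y), (e, b, -z), (e, !b, -y)]) ≠ 1 by
    obtain ⟨n, Φ, hΦ⟩ := h'
    rw [h, ofAdd_zero, map_one, one_mul, map_one] at hΦ
    exact hΦ rfl
  refine exists_hom_perm c g (AddMonoidHom.id _) (fun e m => ?_) (fun e => ?_) 0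
    [(e, b, z), (e, !b, y), (e, b, -z), (e, !b, -y)] ?_ (by simp)
  · simp only [AddMonoidHom.id_apply]
    exact ⟨fun h => by
      by_contra hne
      exact smul_ne_zero_intProd (fun h0 => hne (by rw [h0, zero_smul])) (hw _) h, fun h => by
      by_contra hne
      exact smul_ne_zero_intProd (fun h0 => hne (by rw [h0, zero_smul])) (hw _) h⟩
  · have h1 := infinite_quotient_zmultiples (endVector c g (e, true))
    have h2 := infinite_quotient_zmultiples (endVector c g (e, false))
    have h3 : Countable ((ℤ × ℤ) ⧸ AddSubgroup.zmultiples (endVector c g (e, true))) :=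
      Quotient.countable
    have h4 : Countable ((ℤ × ℤ) ⧸ AddSubgroup.zmultiples (endVector c g (e, false))) :=
      Quotient.countable
    exact nonempty_equiv_of_countable
  · simp [IsReducedWord, hz, hy]

/-- Residual finiteness produces a regulating tuple: it consists of the orders of the edge groups
in a finite quotient in which sufficiently many commutators survive. -/
theorem exists_isRegulated_of_residuallyFinite (c : T.Vert ≃+ ℤ × ℤ) (g : ∀ e, ℤ ≃+ T.Edge e)
    (hG : Group.ResiduallyFinite T.TubularGroup) : ∃ k, IsRegulated (endVector c g) k := by
  classical
  have := T.finite_E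
  have hy : ∀ x : T.E × Bool, ∃ y, y ∉ AddSubgroup.zmultiples (endVector c g x) := by
    intro x
    by_contra! h
    have h1 := infinite_quotient_zmultiples (endVector c g x)
    have h2 : AddSubgroup.zmultiples (endVector c g x) = ⊤ := (AddSubgroup.eq_top_iff' _).2 h
    rw [h2] at h1
    exact not_finite ((ℤ × ℤ) ⧸ (⊤ : AddSubgroup (ℤ × ℤ)))
  choose y hy using hy
  -- the roots of the end vectors, and the commutators detecting them
  let R : T.E × Bool → Set (ℤ × ℤ) := fun x =>
    {z | (∃ p : ℤ, p • z = endVector c g x) ∧ z ∉ AddSubgroup.zmultiples (endVector c g x)}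
  have hR : ∀ x, Finite (R x) := fun x =>
    ((finite_setOf_smul_eq _ (endVector_ne_zero c g x)).subset fun z hz => hz.1).to_subtype
  let com : (Σ x, R x) → T.TubularGroup := fun s =>
    wordEval (baseHom c) stable [(s.1.1, s.1.2, s.2), (s.1.1, !s.1.2, y (s.1.1, !s.1.2)),
      (s.1.1, s.1.2, -s.2), (s.1.1, !s.1.2, -y (s.1.1, !s.1.2))]
  have hcom : ∀ s, com s ≠ 1 := fun s => conj_commutator_ne_one c g _ _ s.2.2.2 (hy _)
  choose H hH using fun s => Group.exists_finiteIndexNormalSubgroup_notMem (com s) (hcom s)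
  let N : Subgroup T.TubularGroup := ⨅ s, (H s).toSubgroup
  have hNn : N.Normal := Subgroup.normal_iInf_normal fun s => inferInstance
  have hNf : N.FiniteIndex := Subgroup.finiteIndex_iInf fun s => inferInstance
  have hNcom : ∀ s, QuotientGroup.mk' N (com s) ≠ 1 := by
    intro s h
    have h1 : com s ∈ N := (QuotientGroup.eq_one_iff _).1 h
    exact hH s (Subgroup.mem_iInf.1 h1 s)
  have hQ : Finite (T.TubularGroup ⧸ N) := inferInstance
  let α : Multiplicative (ℤ × ℤ) →* T.TubularGroup ⧸ N := (QuotientGroup.mk' N).comp (baseHom c)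
  let τ : T.E → T.TubularGroup ⧸ N := fun e => QuotientGroup.mk' N (stable e)
  have hατ : ∀ e, τ e * α (Multiplicative.ofAdd (endVector c g (e, true))) * (τ e)⁻¹ =
      α (Multiplicative.ofAdd (endVector c g (e, false))) := by
    intro e
    have := congrArg (QuotientGroup.mk' N) (stable_conj c g e)
    rwa [map_mul, map_mul, map_inv] at this
  let o : T.E → ℕ := fun e => orderOf (α (Multiplicative.ofAdd (endVector c g (e, true))))
  have ho : ∀ x : T.E × Bool, orderOf (α (Multiplicative.ofAdd (endVector c g x))) = o x.1 := by
    rintro ⟨e, b⟩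
    cases b
    · rw [← hατ]
      exact (MulAut.conj (τ e)).orderOf_eq
        (α (Multiplicative.ofAdd (endVector c g (e, true))))
    · rfl
  have ho0 : ∀ e, 0 < o e := fun e => orderOf_pos _
  refine ⟨fun e => o e, ?_⟩
  have hker : ∀ z ∈ AddSubgroup.closure
      (Set.range fun x : T.E × Bool => (o x.1 : ℤ) • endVector c g x),
      α (Multiplicative.ofAdd z) = 1 := by
    intro z hz
    induction hz using AddSubgroup.closure_induction with
    | mem z hz =>
      obtain ⟨x, rfl⟩ := hz
      rw [ofAdd_zsmul, map_zpow, zpow_natCast, ← ho x, pow_orderOf_eq_one]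
    | zero => rw [ofAdd_zero, map_one]
    | add a b _ _ ha hb => rw [ofAdd_add, map_mul, ha, hb, one_mul]
    | neg a _ ha => rw [ofAdd_neg, map_inv, ha, inv_one]
  intro x
  refine isPrimitiveIn_of_prime (AddSubgroup.subset_closure ⟨x, rfl⟩)
    (smul_ne_zero_intProd (Nat.cast_ne_zero.2 (ho0 _).ne') (endVector_ne_zero c g x)) ?_
  intro p hp z' hz' heq
  dsimp only at heq hz'
  have hp0 : (p : ℤ) ≠ 0 := Nat.cast_ne_zero.2 hp.ne_zero
  set u := endVector c g x with hu
  by_cases hdvd : p ∣ o x.1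
  · -- then a proper divisor of the order of `u` kills `u`
    obtain ⟨m, hm⟩ := hdvd
    have h1 : z' = (m : ℤ) • u := by
      apply smul_left_cancel_intProd hp0
      rw [heq, hm]; push_cast; rw [mul_smul]
    have h2 := hker z' hz'
    rw [h1, ofAdd_zsmul, map_zpow, zpow_natCast] at h2
    have h3 : o x.1 ∣ m := by
      rw [← ho x]
      exact orderOf_dvd_of_pow_eq_one h2
    have hm0 : 0 < m := Nat.pos_of_ne_zero (by rintro rfl; exact (ho0 x.1).ne' (by simpa using hm))
    have h4 := Nat.le_of_dvd hm0 h3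
    have h5 := hp.two_le
    nlinarith
  · -- then the root of `u` of order `p` is, in the quotient, a power of `u`
    obtain ⟨s, t, hst⟩ : IsCoprime (o x.1 : ℤ) (p : ℤ) :=
      Nat.isCoprime_iff_coprime.2 ((Nat.Prime.coprime_iff_not_dvd hp).2 hdvd).symm
    set z : ℤ × ℤ := s • z' + t • u with hz
    have hpz : (p : ℤ) • z = u := by
      calc (p : ℤ) • z = s • ((p : ℤ) • z') + (t * p) • u := by rw [hz]; module
        _ = (s * o x.1 + t * p) • u := by rw [heq]; module
        _ = u := by rw [hst, one_smul]
    have hoz : (o x.1 : ℤ) • z = z' := by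
      apply smul_left_cancel_intProd hp0
      rw [smul_comm, hpz, heq]
    have hzR : z ∉ AddSubgroup.zmultiples u := by
      intro hmem
      obtain ⟨m, hm⟩ := AddSubgroup.mem_zmultiples_iff.1 hmem
      have h1 : ((p : ℤ) * m - 1) • u = 0 := by
        rw [sub_smul, mul_smul, hm, hpz, one_smul, sub_self]
      by_contra _
      have h2 : (p : ℤ) * m - 1 ≠ 0 := by
        intro h
        exact hp.one_lt.ne' (by
          have := Int.isUnit_iff.1 (IsUnit.of_mul_eq_one m (sub_eq_zero.1 h))
          omega)
      exact smul_ne_zero_intProd h2 (endVector_ne_zero c g x) h1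
    have hαz : α (Multiplicative.ofAdd z) = α (Multiplicative.ofAdd (t • u)) := by
      have h1 : z = s • z' + t • u := hz
      rw [h1, ofAdd_add, map_mul, ofAdd_zsmul s, map_zpow, hker z' hz', one_zpow, one_mul]
    obtain ⟨e, b⟩ := x
    refine hNcom ⟨(e, b), z, ⟨p, hpz⟩, hzR⟩ ?_
    have hconj := stable_mul_zsmul hατ e b t
    have hconj' := stable_mul_zsmul hατ e b (-t)
    have hαz' : α (Multiplicative.ofAdd (-z)) = α (Multiplicative.ofAdd (-t • u)) := by
      rw [ofAdd_neg, map_inv, hαz, ← map_inv, ← ofAdd_neg, neg_smul]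
    rw [← hu, ← hαz] at hconj
    rw [← hu, ← hαz'] at hconj'
    change QuotientGroup.mk' N (wordEval _ _ _) = 1
    rw [map_wordEval]
    change wordEval α τ _ = 1
    simp only [wordEval, mul_one]
    calc _ = ((if b = true then τ e else (τ e)⁻¹) * α (Multiplicative.ofAdd z) *
            (if (!b) = true then τ e else (τ e)⁻¹)) * α (Multiplicative.ofAdd (y (e, !b))) *
          ((if b = true then τ e else (τ e)⁻¹) * α (Multiplicative.ofAdd (-z)) *
            (if (!b) = true then τ e else (τ e)⁻¹)) * α (Multiplicative.ofAdd (-y (e, !b))) := by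
          simp only [mul_assoc]
      _ = 1 := by
          rw [hconj, hconj', ← map_mul, ← map_mul, ← map_mul, ← ofAdd_add, ← ofAdd_add,
            ← ofAdd_add]
          rw [show t • endVector c g (e, !b) + y (e, !b) + -t • endVector c g (e, !b) +
            -y (e, !b) = 0 by rw [neg_smul]; abel, ofAdd_zero, map_one]

/-! ### Regulating tuples in coordinates -/

theorem vertexSubgroup_map (c : T.Vert ≃+ ℤ × ℤ) (g : ∀ e, ℤ ≃+ T.Edge e) (k : T.E → ℤ) :
    (T.vertexSubgroup k).map c.toAddMonoidHom =
      AddSubgroup.closure (Set.range fun x : T.E × Bool => k x.1 • endVector c g x) := by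
  apply le_antisymm
  · rw [AddSubgroup.map_le_iff_le_comap]
    refine iSup_le fun e => sup_le ?_ ?_
    all_goals
      rintro _ ⟨_, ⟨y, rfl⟩, rfl⟩
      obtain ⟨m, rfl⟩ := (g e).surjective y
      have hm : g e m = m • g e 1 := by rw [← map_zsmul, smul_eq_mul, mul_one]
    · have : m • k e • endVector c g (e, true) ∈ AddSubgroup.closure
          (Set.range fun x : T.E × Bool => k x.1 • endVector c g x) :=
        AddSubgroup.zsmul_mem _ (AddSubgroup.subset_closure (Set.mem_range_self (e, true))) m
      simpa [endVector, hm, map_zsmul, smul_comm m, -zsmul_eq_mul] using this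
    · have : m • k e • endVector c g (e, false) ∈ AddSubgroup.closure
          (Set.range fun x : T.E × Bool => k x.1 • endVector c g x) :=
        AddSubgroup.zsmul_mem _ (AddSubgroup.subset_closure (Set.mem_range_self (e, false))) m
      simpa [endVector, hm, map_zsmul, smul_comm m, -zsmul_eq_mul] using this
  · rw [AddSubgroup.closure_le]
    rintro _ ⟨⟨e, b⟩, rfl⟩
    refine ⟨k e • (if b then T.neg e (g e 1) else T.pos e (g e 1)), ?_, ?_⟩
    · refine AddSubgroup.mem_iSup_of_mem e ?_
      cases b
      · exact AddSubgroup.mem_sup_right ⟨k e • g e 1, ⟨g e 1, rfl⟩, by simp⟩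
      · exact AddSubgroup.mem_sup_left ⟨k e • g e 1, ⟨g e 1, rfl⟩, by simp⟩
    · cases b <;> simp [endVector, map_zsmul, -zsmul_eq_mul]

theorem isRegulating_iff (c : T.Vert ≃+ ℤ × ℤ) (g : ∀ e, ℤ ≃+ T.Edge e) (k : T.E → ℤ) :
    T.IsRegulating k ↔ IsRegulated (endVector c g) k := by
  have hgen : ∀ e, AddSubgroup.zmultiples (g e 1) = ⊤ := by
    intro e
    refine (AddSubgroup.eq_top_iff' _).2 fun y => ?_
    obtain ⟨m, rfl⟩ := (g e).surjective y
    exact ⟨m, by simp [← map_zsmul]⟩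
  have key : ∀ e b, IsPrimitiveIn (AddSubgroup.closure
      (Set.range fun x : T.E × Bool => k x.1 • endVector c g x)) (k e • endVector c g (e, b)) ↔
      IsPrimitiveIn (T.vertexSubgroup k)
        (if b then T.neg e (k e • g e 1) else T.pos e (k e • g e 1)) := by
    intro e b
    rw [← vertexSubgroup_map, ← isPrimitiveIn_map_equiv_iff c (H := T.vertexSubgroup k)]
    cases b <;> simp [endVector, map_zsmul, -zsmul_eq_mul]
  constructor
  · rintro h ⟨e, b⟩
    refine (key e b).2 ?_
    obtain ⟨h1, h2⟩ := h e (g e 1) (hgen e)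
    cases b
    · exact h2
    · exact h1
  · intro h e y hy
    have h1 : IsPrimitiveIn (T.vertexSubgroup k) (T.neg e (k e • g e 1)) := (key e true).1 (h (e, true))
    have h2 : IsPrimitiveIn (T.vertexSubgroup k) (T.pos e (k e • g e 1)) := (key e false).1 (h (e, false))
    -- a generator of an infinite cyclic group is unique up to sign
    have hy' : y = g e 1 ∨ y = - g e 1 := by
      obtain ⟨m, rfl⟩ := (g e).surjective y
      have h3 : g e 1 ∈ AddSubgroup.zmultiples (g e m) := by rw [hy]; trivial
      obtain ⟨j, hj⟩ := AddSubgroup.mem_zmultiples_iff.1 h3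
      rw [← map_zsmul] at hj
      have h4 : j * m = 1 := (g e).injective hj
      rcases Int.isUnit_iff.1 (IsUnit.of_mul_eq_one j (by rw [mul_comm]; exact h4)) with h5 | h5
      · exact Or.inl (by rw [h5])
      · exact Or.inr (by rw [h5, map_neg])
    rcases hy' with rfl | rfl
    · exact ⟨h1, h2⟩
    · rw [smul_neg, map_neg, map_neg]
      exact ⟨h1.neg, h2.neg⟩

end OneVertexTubular

/-! ### Primitivity through greatest common divisors of determinants -/

section GcdCriterion

variable {J : Type*} [Fintype J]

/-- A member of a family of vectors that spans a lattice `L` of rank two is primitive in `L` if and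
only if its determinants with the family have the same greatest common divisor as all the
determinants of the family. -/
theorem isPrimitiveIn_iff_gcd_dvd (x : J → ℤ × ℤ) (hx : ∃ b c, det (x b) (x c) ≠ 0) (a : J) :
    IsPrimitiveIn (AddSubgroup.closure (Set.range x)) (x a) ↔
      ∀ b c, (Finset.univ.gcd fun b => (det (x a) (x b)).natAbs) ∣ (det (x b) (x c)).natAbs := by
  set L := AddSubgroup.closure (Set.range x) with hL
  set F := Finset.univ.gcd fun b => (det (x a) (x b)).natAbs with hF
  set Δ := Finset.univ.gcd fun p : J × J => (det (x p.1) (x p.2)).natAbs with hΔ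
  have hxL : ∀ b, x b ∈ L := fun b => AddSubgroup.subset_closure ⟨b, rfl⟩
  have hΔdvd : ∀ b c, Δ ∣ (det (x b) (x c)).natAbs := fun b c =>
    Finset.gcd_dvd (Finset.mem_univ (b, c))
  have hLdvd : ∀ y ∈ L, ∀ b, (Δ : ℤ) ∣ det y (x b) := by
    intro y hy b
    induction hy using AddSubgroup.closure_induction with
    | mem y hy =>
      obtain ⟨c, rfl⟩ := hy
      exact Int.natCast_dvd.2 (hΔdvd c b)
    | zero => simp [det]
    | add y z _ _ hy hz => rw [det_add_left]; exact dvd_add hy hz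
    | neg y _ hy => rw [← neg_one_smul ℤ, det_smul_left]; exact Dvd.dvd.mul_left hy _
  have hΔF : Δ ∣ F := Finset.dvd_gcd fun b _ => hΔdvd a b
  have hΔ0 : Δ ≠ 0 := by
    obtain ⟨b, c, h⟩ := hx
    intro h0
    have := hΔdvd b c
    rw [h0, zero_dvd_iff, Int.natAbs_eq_zero] at this
    exact h this
  have hFdvd : ∀ b, (F : ℤ) ∣ det (x a) (x b) := fun b =>
    Int.natCast_dvd.2 (Finset.gcd_dvd (Finset.mem_univ b))
  constructor
  · intro h
    obtain ⟨m, hm⟩ := hΔF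
    -- the multiples of `x a` lying in `F L`, by Cramer's rule, include `Δ • x a`
    let S : AddSubgroup ℤ :=
      (L.map (zsmulAddGroupHom (F : ℤ) : ℤ × ℤ →+ ℤ × ℤ)).comap (zmultiplesHom _ (x a))
    have hS : ∀ b c, det (x b) (x c) ∈ S := by
      intro b c
      obtain ⟨s, hs⟩ := hFdvd b
      obtain ⟨t, ht⟩ := hFdvd c
      refine ⟨t • x b - s • x c, L.sub_mem (L.zsmul_mem (hxL b) t) (L.zsmul_mem (hxL c) s), ?_⟩
      rw [zmultiplesHom_apply, det_smul_eq, hs, ht, zsmulAddGroupHom_apply]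
      module
    obtain ⟨s, hs⟩ := Int.subgroup_cyclic S
    rw [← AddSubgroup.zmultiples_eq_closure] at hs
    have hsΔ : s.natAbs ∣ Δ := by
      refine Finset.dvd_gcd fun p _ => Int.natAbs_dvd_natAbs.2 ?_
      have := hS p.1 p.2
      rw [hs, Int.mem_zmultiples_iff] at this
      exact this
    have hΔS : (Δ : ℤ) ∈ S := by
      rw [hs, Int.mem_zmultiples_iff]
      exact Int.natAbs_dvd.1 (Int.natCast_dvd_natCast.2 hsΔ)
    obtain ⟨y, hy, hy'⟩ := hΔS
    rw [zmultiplesHom_apply, zsmulAddGroupHom_apply, hm] at hy'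
    have h1 : (m : ℤ) • y = x a := by
      apply smul_left_cancel_intProd (Nat.cast_ne_zero.2 hΔ0 : (Δ : ℤ) ≠ 0)
      rw [← hy', smul_smul]; push_cast; rfl
    have h2 : m = 1 := by
      rcases h.2.2 m y hy h1 with h | h <;> omega
    rw [hm, h2, mul_one]
    exact hΔdvd
  · intro h
    have hFΔ : F ∣ Δ := Finset.dvd_gcd fun p _ => h p.1 p.2
    have hF0 : F ≠ 0 := fun h0 => hΔ0 (by rw [h0] at hFΔ; exact zero_dvd_iff.1 hFΔ)
    refine ⟨hxL a, fun h0 => hF0 ?_, fun n y hy hn => ?_⟩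
    · refine Finset.gcd_eq_zero_iff.2 fun b _ => ?_
      simp [h0, det]
    · have hy' := hLdvd y hy
      have h1 : n.natAbs * Δ ∣ F := by
        refine Finset.dvd_gcd fun b _ => ?_
        rw [← hn, det_smul_left, Int.natAbs_mul]
        exact mul_dvd_mul_left _ (Int.natCast_dvd.1 (hy' b))
      have h2 : n.natAbs * Δ ∣ 1 * Δ := by rw [one_mul]; exact h1.trans hFΔ
      have h3 : n.natAbs = 1 := Nat.dvd_one.1 (Nat.dvd_of_mul_dvd_mul_right (Nat.pos_of_ne_zero hΔ0) h2)
      omega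

/-- The local form of the criterion: the largest power of `q` dividing all the numbers `P a b` is
already attained in every row. -/
theorem gcd_dvd_iff_forall_prime (P : J → J → ℕ) (hP : ∃ b c, P b c ≠ 0) :
    (∀ a b c, (Finset.univ.gcd (P a)) ∣ P b c) ↔
      ∀ q : ℕ, q.Prime → ∃ C : ℕ, (∀ a b, q ^ C ∣ P a b) ∧ ∀ a, ∃ b, ¬ q ^ (C + 1) ∣ P a b := by
  set Δ := Finset.univ.gcd fun p : J × J => P p.1 p.2 with hΔ
  have hΔdvd : ∀ b c, Δ ∣ P b c := fun b c => Finset.gcd_dvd (Finset.mem_univ (b, c))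
  have hΔ0 : Δ ≠ 0 := by
    obtain ⟨b, c, h⟩ := hP
    intro h0
    have := hΔdvd b c
    rw [h0, zero_dvd_iff] at this
    exact h this
  constructor
  · intro h q hq
    refine ⟨Δ.factorization q, fun a b => (Nat.ordProj_dvd _ _).trans (hΔdvd a b), fun a => ?_⟩
    by_contra! hcon
    have h1 : q ^ (Δ.factorization q + 1) ∣ Δ := by
      refine Finset.dvd_gcd fun p _ => ?_
      exact (Finset.dvd_gcd fun b _ => hcon b).trans (h a p.1 p.2)
    exact Nat.pow_succ_factorization_not_dvd hΔ0 hq h1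
  · intro h a b c
    refine dvd_trans ?_ (hΔdvd b c)
    obtain ⟨m, hm⟩ : Δ ∣ Finset.univ.gcd (P a) := Finset.dvd_gcd fun b _ => hΔdvd a b
    by_cases hm1 : m = 1
    · rw [hm, hm1, mul_one]
    exfalso
    obtain ⟨q, hq, hqm⟩ := Nat.exists_prime_and_dvd hm1
    obtain ⟨C, hC, hC'⟩ := h q hq
    obtain ⟨b, hb⟩ := hC' a
    apply hb
    have h1 : q ^ C ∣ Δ := Finset.dvd_gcd fun p _ => hC p.1 p.2
    rw [pow_succ]
    exact ((mul_dvd_mul h1 hqm).trans (hm ▸ dvd_rfl)).trans (Finset.gcd_dvd (Finset.mem_univ b))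

end GcdCriterion

/-! ### Bounding regulating tuples -/

section Bound

theorem pow_succ_dvd_of_mul {p : ℕ} (hp : p.Prime) {D C : ℕ} {x y : ℤ}
    (hx : ¬ (p : ℤ) ^ (D + 1) ∣ x) (h : (p : ℤ) ^ (D + 1 + C) ∣ x * y) : (p : ℤ) ^ (C + 1) ∣ y := by
  have hp' : Prime (p : ℤ) := Nat.prime_iff_prime_int.1 hp
  rw [pow_dvd_iff_le_emultiplicity] at hx h ⊢
  rw [emultiplicity_mul hp'] at h
  rw [not_le] at hx
  generalize emultiplicity (p : ℤ) x = s at *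
  generalize emultiplicity (p : ℤ) y = t at *
  induction t with
  | top => exact le_top
  | coe t =>
    have hs : s ≠ ⊤ := ne_top_of_lt hx
    lift s to ℕ using hs
    norm_cast at *
    omega

variable {ι : Type*}

/-- The condition for being regulated, at the prime `p`, on a tuple whose entries have `p`-adic
valuations `e`: the smallest valuation `C` of the determinants of the scaled vectors
`p ^ e i • w (i, b)` is attained in each row of the matrix of these determinants. -/
def IsTightAt (p : ℕ) (w : ι × Bool → ℤ × ℤ) (e : ι → ℕ) : Prop :=
  ∃ C : ℕ, (∀ a b, (p : ℤ) ^ C ∣ (p : ℤ) ^ (e a.1 + e b.1) * det (w a) (w b)) ∧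
    ∀ a, ∃ b, ¬ (p : ℤ) ^ (C + 1) ∣ (p : ℤ) ^ (e a.1 + e b.1) * det (w a) (w b)

/-- Closing gaps: if the valuations in `S` exceed the other ones by more than the valuations `D` of
the data, then those in `S` can be lowered by one. -/
theorem IsTightAt.lower {p : ℕ} (hp : p.Prime) {w : ι × Bool → ℤ × ℤ} {e : ι → ℕ}
    (h : IsTightAt p w e) {D : ℕ} (hdet : ∀ a b, det (w a) (w b) ≠ 0 →
      ¬ (p : ℤ) ^ (D + 1) ∣ det (w a) (w b))
    (hcoord : ∀ a, ¬ (p : ℤ) ^ (D + 1) ∣ (w a).1 ∨ ¬ (p : ℤ) ^ (D + 1) ∣ (w a).2)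
    (S : ι → Prop) [DecidablePred S] {i₀ : ι} (hi₀ : S i₀) (hpos : ∀ i, S i → 1 ≤ e i)
    (hgap : ∀ s r, S s → ¬ S r → e r + D + 1 ≤ e s) :
    IsTightAt p w fun i => if S i then e i - 1 else e i := by
  obtain ⟨C, hC, hC'⟩ := h
  have hp0 : (p : ℤ) ≠ 0 := Nat.cast_ne_zero.2 hp.ne_zero
  -- the exponent of a vector with index in `S` beats the one of a vector with index outside
  have hraise : ∀ a r b : ι × Bool, S a.1 → ¬ S r.1 →
      (p : ℤ) ^ (D + 1 + C) ∣ (p : ℤ) ^ (e a.1 + e b.1) * det (w r) (w b) := by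
    intro a r b ha hr
    obtain ⟨t, ht⟩ := Nat.exists_eq_add_of_le (hgap _ _ ha hr)
    have : (p : ℤ) ^ (e a.1 + e b.1) * det (w r) (w b) =
        (p : ℤ) ^ t * ((p : ℤ) ^ (D + 1) * ((p : ℤ) ^ (e r.1 + e b.1) * det (w r) (w b))) := by
      rw [ht]; ring
    rw [this, pow_add]
    exact Dvd.dvd.mul_left (mul_dvd_mul_left _ (hC r b)) _
  by_cases hR : ∃ r, ¬ S r
  · obtain ⟨r₀, hr₀⟩ := hR
    by_cases h2 : ∃ r s : ι × Bool, ¬ S r.1 ∧ ¬ S s.1 ∧ det (w r) (w s) ≠ 0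
    · -- the vectors outside `S` span a lattice of rank two, in which those of `S` are divisible
      exfalso
      obtain ⟨r, s, hr, hs, hrs⟩ := h2
      obtain ⟨b, hb⟩ := hC' (i₀, true)
      apply hb
      refine pow_succ_dvd_of_mul hp (hdet r s hrs) ?_
      set a : ι × Bool := (i₀, true)
      have : det (w r) (w s) * ((p : ℤ) ^ (e a.1 + e b.1) * det (w a) (w b)) =
          det (w a) (w s) * ((p : ℤ) ^ (e a.1 + e b.1) * det (w r) (w b)) -
          det (w a) (w r) * ((p : ℤ) ^ (e a.1 + e b.1) * det (w s) (w b)) := by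
        simp only [det]; ring
      rw [this]
      exact dvd_sub (Dvd.dvd.mul_left (hraise a r b hi₀ hr) _)
        (Dvd.dvd.mul_left (hraise a s b hi₀ hs) _)
    · push Not at h2
      -- the vectors outside `S` are parallel: only determinants of one vector in `S` and one outside
      -- attain the minimum `C`, because those within `S` are divisible by `p ^ (C + 1)`
      have hSS : ∀ a b : ι × Bool, S a.1 → S b.1 →
          (p : ℤ) ^ (C + 1) ∣ (p : ℤ) ^ (e a.1 + e b.1) * det (w a) (w b) := by
        intro a b ha hb
        set r : ι × Bool := (r₀, true)
        have h3 := hraise a r b ha hr₀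
        have h4 := hraise b r a hb hr₀
        rcases hcoord r with hx | hx
        · refine pow_succ_dvd_of_mul hp hx ?_
          have : (w r).1 * ((p : ℤ) ^ (e a.1 + e b.1) * det (w a) (w b)) =
              (w a).1 * ((p : ℤ) ^ (e a.1 + e b.1) * det (w r) (w b)) -
              (w b).1 * ((p : ℤ) ^ (e b.1 + e a.1) * det (w r) (w a)) := by
            simp only [det]; ring
          rw [this]
          exact dvd_sub (Dvd.dvd.mul_left h3 _) (Dvd.dvd.mul_left h4 _)
        · refine pow_succ_dvd_of_mul hp hx ?_
          have : (w r).2 * ((p : ℤ) ^ (e a.1 + e b.1) * det (w a) (w b)) =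
              (w a).2 * ((p : ℤ) ^ (e a.1 + e b.1) * det (w r) (w b)) -
              (w b).2 * ((p : ℤ) ^ (e b.1 + e a.1) * det (w r) (w a)) := by
            simp only [det]; ring
          rw [this]
          exact dvd_sub (Dvd.dvd.mul_left h3 _) (Dvd.dvd.mul_left h4 _)
      have hCpos : C ≠ 0 := by
        rintro rfl
        obtain ⟨b, hb⟩ := hC' (i₀, true)
        apply hb
        obtain ⟨t, ht⟩ := Nat.exists_eq_add_of_le (hpos _ hi₀)
        exact ⟨(p : ℤ) ^ (t + e b.1) * det (w (i₀, true)) (w b), by simp only [ht]; ring⟩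
      obtain ⟨C, rfl⟩ := Nat.exists_eq_succ_of_ne_zero hCpos
      have hSR : ∀ a b : ι × Bool, S a.1 → ¬ S b.1 → (p : ℤ) ^ (e a.1 + e b.1) =
          (p : ℤ) * (p : ℤ) ^ ((if S a.1 then e a.1 - 1 else e a.1) +
            (if S b.1 then e b.1 - 1 else e b.1)) := by
        intro a b ha hb
        rw [if_pos ha, if_neg hb, ← pow_succ']
        congr 1
        have := hpos _ ha
        omega
      have hRS : ∀ a b : ι × Bool, ¬ S a.1 → S b.1 → (p : ℤ) ^ (e a.1 + e b.1) =
          (p : ℤ) * (p : ℤ) ^ ((if S a.1 then e a.1 - 1 else e a.1) +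
            (if S b.1 then e b.1 - 1 else e b.1)) := by
        intro a b ha hb
        rw [add_comm, hSR b a hb ha, add_comm (if S b.1 then _ else _)]
      refine ⟨C, fun a b => ?_, fun a => ?_⟩
      · by_cases ha : S a.1 <;> by_cases hb : S b.1
        · have h3 := hSS a b ha hb
          dsimp only
          rw [if_pos ha, if_pos hb]
          obtain ⟨s, hs⟩ := Nat.exists_eq_add_of_le (hpos _ ha)
          obtain ⟨t, ht⟩ := Nat.exists_eq_add_of_le (hpos _ hb)
          have e1 : (p : ℤ) ^ (e a.1 + e b.1) * det (w a) (w b) =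
              (p : ℤ) ^ 2 * ((p : ℤ) ^ (e a.1 - 1 + (e b.1 - 1)) * det (w a) (w b)) := by
            rw [hs, ht, Nat.add_sub_cancel_left, Nat.add_sub_cancel_left]; ring
          rw [e1, show C.succ + 1 = 2 + C by omega, pow_add] at h3
          exact (mul_dvd_mul_iff_left (pow_ne_zero 2 hp0)).1 h3
        · have h3 := hC a b
          rw [hSR a b ha hb, mul_assoc, pow_succ'] at h3
          exact (mul_dvd_mul_iff_left hp0).1 h3
        · have h3 := hC a b
          rw [hRS a b ha hb, mul_assoc, pow_succ'] at h3
          exact (mul_dvd_mul_iff_left hp0).1 h3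
        · rw [h2 a b ha hb, mul_zero]
          exact dvd_zero _
      · obtain ⟨b, hb⟩ := hC' a
        refine ⟨b, fun hdvd => hb ?_⟩
        by_cases ha : S a.1 <;> by_cases hb' : S b.1
        · exact hSS a b ha hb'
        · rw [hSR a b ha hb', mul_assoc, pow_succ']
          exact mul_dvd_mul_left _ hdvd
        · rw [hRS a b ha hb', mul_assoc, pow_succ']
          exact mul_dvd_mul_left _ hdvd
        · rw [h2 a b ha hb', mul_zero]
          exact dvd_zero _
  · -- all the valuations are positive, so that the whole tuple is divisible by `p`
    push Not at hR
    have e1 : ∀ a b : ι × Bool, (p : ℤ) ^ (e a.1 + e b.1) * det (w a) (w b) =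
        (p : ℤ) ^ 2 * ((p : ℤ) ^ (e a.1 - 1 + (e b.1 - 1)) * det (w a) (w b)) := by
      intro a b
      obtain ⟨s, hs⟩ := Nat.exists_eq_add_of_le (hpos _ (hR a.1))
      obtain ⟨t, ht⟩ := Nat.exists_eq_add_of_le (hpos _ (hR b.1))
      rw [hs, ht, Nat.add_sub_cancel_left, Nat.add_sub_cancel_left]; ring
    have hC2 : 2 ≤ C := by
      by_contra hlt
      obtain ⟨b, hb⟩ := hC' (i₀, true)
      apply hb
      rw [e1]
      exact Dvd.dvd.mul_right (pow_dvd_pow _ (by omega)) _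
    obtain ⟨C, rfl⟩ := Nat.exists_eq_add_of_le hC2
    refine ⟨C, fun a b => ?_, fun a => ?_⟩
    · have h3 := hC a b
      dsimp only
      rw [if_pos (hR _), if_pos (hR _)]
      rw [e1, pow_add] at h3
      exact (mul_dvd_mul_iff_left (pow_ne_zero 2 hp0)).1 h3
    · obtain ⟨b, hb⟩ := hC' a
      refine ⟨b, fun hdvd => hb ?_⟩
      dsimp only at hdvd
      rw [if_pos (hR _), if_pos (hR _)] at hdvd
      rw [e1, add_assoc, pow_add]
      exact mul_dvd_mul_left _ hdvd

/-- Among `n` natural numbers one of which exceeds `n D`, there is a gap of length `D` below it. -/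
theorem exists_gap {n D : ℕ} (e : Fin n → ℕ) {i₀ : Fin n} (h : n * D < e i₀) :
    ∃ c, c + D < e i₀ ∧ ∀ i, e i ≤ c ∨ c + D < e i := by
  by_contra! hcon
  have h1 : ∀ j : Fin n, ∃ i, (j : ℕ) * D < e i ∧ e i ≤ j * D + D := by
    intro j
    refine hcon (j * D) (lt_of_le_of_lt ?_ h)
    calc (j : ℕ) * D + D = (j + 1) * D := by ring
      _ ≤ n * D := Nat.mul_le_mul_right _ j.2
  choose f hf using h1
  have hinj : Function.Injective f := by
    have hlt : ∀ j j' : Fin n, j < j' → f j ≠ f j' := by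
      intro j j' hjj heq
      have h2 := (hf j).2
      have h3 := (hf j').1
      rw [heq] at h2
      have h4 : ((j : ℕ) + 1) * D ≤ j' * D := Nat.mul_le_mul_right _ hjj
      nlinarith
    intro j j' heq
    rcases lt_trichotomy j j' with h2 | h2 | h2
    · exact absurd heq (hlt _ _ h2)
    · exact h2
    · exact absurd heq.symm (hlt _ _ h2)
  obtain ⟨j, hj⟩ := (Finite.injective_iff_surjective.1 hinj) i₀
  have h2 := (hf j).2
  rw [hj] at h2
  have h3 : ((j : ℕ) + 1) * D ≤ n * D := Nat.mul_le_mul_right _ j.2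
  nlinarith

/-- A tuple that is tight at all primes can be replaced by one whose entries divide `M ^ n`. -/
theorem exists_tight_dvd {n : ℕ} (w : Fin n × Bool → ℤ × ℤ) {M : ℕ} (hM : M ≠ 0)
    (hdet : ∀ a b, det (w a) (w b) ≠ 0 → det (w a) (w b) ∣ M)
    (hcoord : ∀ a, ((w a).1 ∣ (M : ℤ)) ∨ ((w a).2 ∣ (M : ℤ))) (k : Fin n → ℕ) (hk : ∀ i, k i ≠ 0)
    (ht : ∀ p : ℕ, p.Prime → IsTightAt p w fun i => (k i).factorization p) :
    ∃ k' : Fin n → ℕ, (∀ i, k' i ∣ M ^ n) ∧ (∀ i, k' i ≠ 0) ∧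
      ∀ p : ℕ, p.Prime → IsTightAt p w fun i => (k' i).factorization p := by
  classical
  induction hs : ∑ i, k i using Nat.strong_induction_on generalizing k with
  | _ s ih =>
    by_cases hall : ∀ i, k i ∣ M ^ n
    · exact ⟨k, hall, hk, ht⟩
    push Not at hall
    obtain ⟨i₀, hi₀⟩ := hall
    obtain ⟨p, hp⟩ : ∃ p, (M ^ n).factorization p < (k i₀).factorization p := by
      by_contra! hcon
      exact hi₀ ((Nat.factorization_le_iff_dvd (hk i₀) (pow_ne_zero _ hM)).1 hcon)
    have hpp : p.Prime := by
      by_contra hnp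
      rw [Nat.factorization_eq_zero_of_not_prime (k i₀) hnp] at hp
      exact absurd hp (Nat.not_lt_zero _)
    rw [Nat.factorization_pow, Finsupp.smul_apply, smul_eq_mul] at hp
    obtain ⟨c, hc0, hc⟩ := exists_gap (fun i => (k i).factorization p) hp
    set S : Fin n → Prop := fun i => c + M.factorization p < (k i).factorization p with hS
    have hMp : ∀ d : ℤ, d ∣ (M : ℤ) → ¬ (p : ℤ) ^ (M.factorization p + 1) ∣ d := by
      intro d hd hdvd
      have h1 := hdvd.trans hd
      have h2 : p ^ (M.factorization p + 1) ∣ M := by exact_mod_cast h1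
      exact Nat.pow_succ_factorization_not_dvd hM hpp h2
    have hlow := (ht p hpp).lower hpp (D := M.factorization p)
      (fun a b hab => hMp _ (hdet a b hab))
      (fun a => (hcoord a).imp (hMp _) (hMp _)) S (i₀ := i₀) hc0
      (fun i hi => by have : c + M.factorization p < (k i).factorization p := hi; omega)
      (fun s r hs hr => by
        have h1 : c + M.factorization p < (k s).factorization p := hs
        have h2 := (hc r).resolve_right hr
        omega)
    have hpS : ∀ i, S i → p ∣ k i := fun i hi => by
      have : c + M.factorization p < (k i).factorization p := hi
      exact Nat.dvd_of_factorization_pos (by omega)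
    set k' : Fin n → ℕ := fun i => if S i then k i / p else k i with hk'
    have hk'0 : ∀ i, k' i ≠ 0 := by
      intro i
      simp only [hk']
      split_ifs with hi
      · exact (Nat.div_pos (Nat.le_of_dvd (Nat.pos_of_ne_zero (hk i)) (hpS i hi)) hpp.pos).ne'
      · exact hk i
    have hk'le : ∀ i, k' i ≤ k i := by
      intro i
      simp only [hk']
      split_ifs
      · exact Nat.div_le_self _ _
      · exact le_rfl
    refine ih (∑ i, k' i) ?_ k' hk'0 ?_ rfl
    · rw [← hs]
      refine Finset.sum_lt_sum (fun i _ => hk'le i) ⟨i₀, Finset.mem_univ _, ?_⟩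
      have hi₀S : S i₀ := hc0
      simp only [hk', if_pos hi₀S]
      exact Nat.div_lt_self (Nat.pos_of_ne_zero (hk i₀)) hpp.one_lt
    · intro q hq
      by_cases hqp : q = p
      · subst hqp
        convert hlow using 2 with i
        simp only [hk']
        split_ifs with hi
        · rw [Nat.factorization_div (hpS i hi), Finsupp.coe_tsub, Pi.sub_apply, hq.factorization_self]
        · rfl
      · convert ht q hq using 2 with i
        simp only [hk']
        split_ifs with hi
        · rw [Nat.factorization_div (hpS i hi), Finsupp.coe_tsub, Pi.sub_apply,
            hpp.factorization, Finsupp.single_apply, if_neg (fun h => hqp h.symm), Nat.sub_zero]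
        · rfl

end Bound

/-! ### Criteria for the existence of a regulating tuple -/

section Criterion

theorem IsRegulated.ne_zero {ι : Type*} {w : ι × Bool → ℤ × ℤ} {k : ι → ℤ} (h : IsRegulated w k)
    (i : ι) : k i ≠ 0 := by
  intro h0
  exact (h (i, true)).2.1 (by simp [h0])

theorem isRegulated_iff_gcd_dvd {ι : Type*} [Fintype ι] {w : ι × Bool → ℤ × ℤ}
    (hw : ∃ a b, det (w a) (w b) ≠ 0) {k : ι → ℤ} (hk : ∀ i, k i ≠ 0) :
    IsRegulated w k ↔ ∀ a b c : ι × Bool,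
      (Finset.univ.gcd fun b : ι × Bool =>
        (k a.1).natAbs * (k b.1).natAbs * (det (w a) (w b)).natAbs) ∣
      (k b.1).natAbs * (k c.1).natAbs * (det (w b) (w c)).natAbs := by
  have h1 : ∀ a b : ι × Bool, (det (k a.1 • w a) (k b.1 • w b)).natAbs =
      (k a.1).natAbs * (k b.1).natAbs * (det (w a) (w b)).natAbs := by
    intro a b
    rw [det_smul_left, det_smul_right, Int.natAbs_mul, Int.natAbs_mul, mul_assoc]
  have h2 : ∃ b c : ι × Bool, det (k b.1 • w b) (k c.1 • w c) ≠ 0 := by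
    obtain ⟨a, b, h⟩ := hw
    refine ⟨a, b, ?_⟩
    rw [det_smul_left, det_smul_right]
    exact mul_ne_zero (hk _) (mul_ne_zero (hk _) h)
  refine forall_congr' fun a => ?_
  rw [isPrimitiveIn_iff_gcd_dvd _ h2 a]
  simp only [h1]

theorem pow_dvd_mul_natAbs_iff {q : ℕ} (hq : q.Prime) {k l : ℕ} (hk : k ≠ 0) (hl : l ≠ 0) (d : ℤ)
    (m : ℕ) : q ^ m ∣ k * l * d.natAbs ↔
      (q : ℤ) ^ m ∣ (q : ℤ) ^ (k.factorization q + l.factorization q) * d := by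
  have h1 : (q : ℤ) ^ m ∣ (q : ℤ) ^ (k.factorization q + l.factorization q) * d ↔
      q ^ m ∣ q ^ (k.factorization q + l.factorization q) * d.natAbs := by
    rw [← Nat.cast_pow, Int.natCast_dvd, Int.natAbs_mul, Int.natAbs_pow, Int.natAbs_natCast]
  rw [h1]
  by_cases hd : d.natAbs = 0
  · simp [hd]
  · rw [hq.pow_dvd_iff_le_factorization (by positivity),
      hq.pow_dvd_iff_le_factorization (mul_ne_zero (pow_ne_zero _ hq.ne_zero) hd),
      Nat.factorization_mul (by positivity) hd, Nat.factorization_mul hk hl,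
      Nat.factorization_mul (pow_ne_zero _ hq.ne_zero) hd, hq.factorization_pow]
    simp

theorem isRegulated_iff_isTightAt {ι : Type*} [Fintype ι] {w : ι × Bool → ℤ × ℤ}
    (hw : ∃ a b, det (w a) (w b) ≠ 0) {k : ι → ℤ} (hk : ∀ i, k i ≠ 0) :
    IsRegulated w k ↔
      ∀ p : ℕ, p.Prime → IsTightAt p w fun i => (k i).natAbs.factorization p := by
  have hk' : ∀ i, (k i).natAbs ≠ 0 := fun i => Int.natAbs_ne_zero.2 (hk i)
  rw [isRegulated_iff_gcd_dvd hw hk, gcd_dvd_iff_forall_prime fun a b : ι × Bool =>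
    (k a.1).natAbs * (k b.1).natAbs * (det (w a) (w b)).natAbs]
  · refine forall_congr' fun p => forall_congr' fun hp => ?_
    simp only [pow_dvd_mul_natAbs_iff hp (hk' _) (hk' _)]
    rfl
  · obtain ⟨a, b, h⟩ := hw
    exact ⟨a, b, mul_ne_zero (mul_ne_zero (hk' _) (hk' _)) (Int.natAbs_ne_zero.2 h)⟩

/-- For systems of rank two, regulating tuples can be found by a bounded search. -/
theorem exists_isRegulated_iff_of_det_ne_zero {n : ℕ} {w : Fin n × Bool → ℤ × ℤ}
    (hw : ∃ a b, det (w a) (w b) ≠ 0) {M : ℕ} (hM : M ≠ 0)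
    (hdet : ∀ a b, det (w a) (w b) ≠ 0 → det (w a) (w b) ∣ M)
    (hcoord : ∀ a, ((w a).1 ∣ (M : ℤ)) ∨ ((w a).2 ∣ (M : ℤ))) :
    (∃ k, IsRegulated w k) ↔ ∃ k : Fin n → ℕ, (∀ i, k i ≠ 0 ∧ k i ≤ M ^ n) ∧
      ∀ a b c : Fin n × Bool,
        (Finset.univ.gcd fun b : Fin n × Bool =>
          k a.1 * k b.1 * (det (w a) (w b)).natAbs) ∣ k b.1 * k c.1 * (det (w b) (w c)).natAbs := by
  constructor
  · rintro ⟨k, hk⟩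
    have h0 := hk.ne_zero
    obtain ⟨k', hdvd, hk'0, ht⟩ := exists_tight_dvd w hM hdet hcoord (fun i => (k i).natAbs)
      (fun i => Int.natAbs_ne_zero.2 (h0 i)) ((isRegulated_iff_isTightAt hw h0).1 hk)
    refine ⟨k', fun i => ⟨hk'0 i, Nat.le_of_dvd (Nat.pos_of_ne_zero (pow_ne_zero _ hM)) (hdvd i)⟩, ?_⟩
    have h1 : ∀ i, (k' i : ℤ) ≠ 0 := fun i => Nat.cast_ne_zero.2 (hk'0 i)
    have h2 := (isRegulated_iff_gcd_dvd hw h1).1 ((isRegulated_iff_isTightAt hw h1).2 ht)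
    exact h2
  · rintro ⟨k, hk, h⟩
    exact ⟨fun i => k i,
      (isRegulated_iff_gcd_dvd hw fun i => Nat.cast_ne_zero.2 (hk i).1).2 h⟩

/-- For systems of rank one, a regulating tuple exists if and only if the vectors of each pair agree
up to sign. -/
theorem exists_isRegulated_iff_of_det_eq_zero {ι : Type*} [Fintype ι] {w : ι × Bool → ℤ × ℤ}
    (hw : ∀ a, w a ≠ 0) (hdet : ∀ a b, det (w a) (w b) = 0) :
    (∃ k, IsRegulated w k) ↔ ∀ i, w (i, true) = w (i, false) ∨ w (i, true) = -w (i, false) := by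
  classical
  constructor
  · rintro ⟨k, hk⟩ i
    have h0 := hk.ne_zero i
    obtain ⟨α, β, hα, h⟩ := exists_smul_eq_of_det_eq_zero (hk (i, false)).2.1
      (y := k i • w (i, true)) (by rw [det_smul_left, det_smul_right, hdet]; simp)
    obtain ⟨j, hj⟩ := (hk (i, false)).exists_eq_smul (hk (i, true)).1 hα h
    have hj' : j = 1 ∨ j = -1 := (hk (i, true)).2.2 j _ (hk (i, false)).1 hj.symm
    rcases hj' with rfl | rfl
    · left
      exact smul_left_cancel_intProd h0 (by rw [hj]; simp)
    · right
      exact smul_left_cancel_intProd h0 (by rw [hj]; simp)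
  · intro h
    -- a coordinate that is nonzero on all the vectors
    obtain ⟨π, hπ, hπinj⟩ : ∃ π : ℤ × ℤ →+ ℤ, (∀ a, π (w a) ≠ 0) ∧
        ∀ x y, det x y = 0 → π x = π y → π x ≠ 0 → x = y := by
      by_cases h1 : ∃ a, (w a).1 = 0
      · obtain ⟨a, ha⟩ := h1
        have ha2 : (w a).2 ≠ 0 := fun h2 => hw a (Prod.ext ha h2)
        refine ⟨AddMonoidHom.snd ℤ ℤ, fun b hb => hw b (Prod.ext ?_ hb), fun x y hd hxy hx => ?_⟩
        · have := hdet a b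
          simp only [det, ha, zero_mul, zero_sub, neg_eq_zero] at this
          exact (mul_eq_zero.1 this).resolve_left ha2
        · simp only [AddMonoidHom.coe_snd] at hxy hx
          refine Prod.ext (mul_left_cancel₀ hx ?_) hxy
          simp only [det] at hd
          rw [← hxy] at hd
          linarith
      · push Not at h1
        refine ⟨AddMonoidHom.fst ℤ ℤ, h1, fun x y hd hxy hx => ?_⟩
        simp only [AddMonoidHom.coe_fst] at hxy hx
        refine Prod.ext hxy (mul_left_cancel₀ hx ?_)
        simp only [det] at hd
        rw [← hxy] at hd
        linarith
    set k : ι → ℤ := fun i => ∏ j ∈ Finset.univ.erase i, π (w (j, true)) with hk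
    have hprod : ∀ i, π (k i • w (i, true)) = ∏ j, π (w (j, true)) := by
      intro i
      rw [map_zsmul, smul_eq_mul, mul_comm, hk]
      exact Finset.mul_prod_erase Finset.univ (fun j => π (w (j, true))) (Finset.mem_univ i)
    have hprod0 : ∏ j, π (w (j, true)) ≠ 0 := Finset.prod_ne_zero_iff.2 fun j _ => hπ _
    have heq : ∀ i j, k i • w (i, true) = k j • w (j, true) := by
      intro i j
      refine hπinj _ _ ?_ ?_ ?_
      · rw [det_smul_left, det_smul_right, hdet]; simp
      · rw [hprod, hprod]
      · rw [hprod]; exact hprod0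
    refine ⟨k, fun x => ?_⟩
    set g := k x.1 • w (x.1, true) with hg
    have hg0 : g ≠ 0 := fun h0 => hprod0 (by rw [← hprod x.1, ← hg, h0, map_zero])
    have hall : ∀ y : ι × Bool, k y.1 • w y = g ∨ k y.1 • w y = -g := by
      rintro ⟨j, b⟩
      cases b
      · rcases h j with hj | hj
        · left; rw [← hj]; exact heq _ _
        · right; rw [hg, heq x.1 j, hj, smul_neg, neg_neg]
      · left; exact heq _ _
    have hL : AddSubgroup.closure (Set.range fun x : ι × Bool => k x.1 • w x) ≤
        AddSubgroup.zmultiples g := by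
      rw [AddSubgroup.closure_le]
      rintro _ ⟨y, rfl⟩
      rcases hall y with hy | hy
      · exact ⟨1, by simp [hy]⟩
      · exact ⟨-1, by simp [hy]⟩
    have hgprim : IsPrimitiveIn (AddSubgroup.closure
        (Set.range fun x : ι × Bool => k x.1 • w x)) g := by
      refine ⟨AddSubgroup.subset_closure ⟨(x.1, true), rfl⟩, hg0, fun n y hy hn => ?_⟩
      obtain ⟨j, rfl⟩ := AddSubgroup.mem_zmultiples_iff.1 (hL hy)
      refine Int.isUnit_iff.1 (IsUnit.of_mul_eq_one j ?_)
      by_contra hne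
      refine smul_ne_zero_intProd (sub_ne_zero.2 hne) hg0 ?_
      rw [sub_smul, one_smul, mul_smul, hn, sub_self]
    rcases hall x with hx | hx
    · rw [hx]; exact hgprim
    · rw [hx]; exact hgprim.neg

end Criterion

/-! ### Primitive recursive functions -/

section PrimitiveRecursion

theorem PrimrecRel.forall_lt_of {α : Type*} [Primcodable α] {n : α → ℕ} {R : ℕ → α → Prop}
    (hn : Primrec n) (hR : PrimrecRel R) : PrimrecPred fun a => ∀ x < n a, R x a :=
  (hR.forall_mem_list.comp (Primrec.list_range.comp hn) Primrec.id).of_eq (by simp)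

theorem PrimrecRel.exists_lt_of {α : Type*} [Primcodable α] {n : α → ℕ} {R : ℕ → α → Prop}
    (hn : Primrec n) (hR : PrimrecRel R) : PrimrecPred fun a => ∃ x < n a, R x a :=
  (hR.exists_mem_list.comp (Primrec.list_range.comp hn) Primrec.id).of_eq (by simp)

theorem primrecRel_dvd : PrimrecRel fun a b : ℕ => a ∣ b :=
  (Primrec.eq.comp (Primrec.nat_mod.comp Primrec.snd Primrec.fst) (Primrec.const 0)).of_eq
    fun _ => Nat.dvd_iff_mod_eq_zero.symm

theorem primrec_gcd : Primrec₂ Nat.gcd := by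
  classical
  have hp : PrimrecRel fun (x : ℕ × ℕ) (d : ℕ) => d ∣ x.1 ∧ d ∣ x.2 :=
    PrimrecPred.and
      (primrecRel_dvd.comp Primrec.snd (Primrec.fst.comp Primrec.fst))
      (primrecRel_dvd.comp Primrec.snd (Primrec.snd.comp Primrec.fst))
  refine (Primrec.nat_findGreatest (f := fun x : ℕ × ℕ => x.1 + x.2)
    (Primrec.nat_add.comp Primrec.fst Primrec.snd) hp).of_eq ?_
  rintro ⟨a, b⟩
  refine (Nat.findGreatest_eq_iff).2 ⟨?_, fun _ => ⟨Nat.gcd_dvd_left _ _, Nat.gcd_dvd_right _ _⟩, ?_⟩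
  · rcases Nat.eq_zero_or_pos a with rfl | ha
    · simp
    · exact (Nat.gcd_le_left _ ha).trans (Nat.le_add_right _ _)
  · rintro m hm hle ⟨h1, h2⟩
    have h3 := Nat.dvd_gcd h1 h2
    rcases Nat.eq_zero_or_pos (Nat.gcd a b) with h0 | h0
    · have := Nat.gcd_eq_zero_iff.1 h0
      dsimp only at hle
      omega
    · exact absurd (Nat.le_of_dvd h0 h3) (not_le.2 hm)

theorem primrec_pow : Primrec₂ fun a b : ℕ => a ^ b := by
  refine Primrec₂.of_eq (Primrec.nat_rec (Primrec.const 1) (g := fun a (p : ℕ × ℕ) => p.2 * a)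
    (Primrec.nat_mul.comp (Primrec.snd.comp Primrec.snd) Primrec.fst)) fun a n => ?_
  induction n with
  | zero => rfl
  | succ n ih => exact (congrArg (· * a) ih).trans (pow_succ a n).symm

theorem primrec_factorial : Primrec Nat.factorial := by
  refine (Primrec.nat_rec₁ (f := fun n r => (n + 1) * r) 1
    (Primrec.nat_mul.comp (Primrec.succ.comp Primrec.fst) Primrec.snd)).of_eq fun n => ?_
  induction n with
  | zero => rfl
  | succ n ih => exact congrArg ((n + 1) * ·) ih

theorem primrec_intToNat : Primrec Int.toNat := by
  refine (Primrec.ite (Primrec.eq.comp (Primrec.nat_mod.comp Primrec.encode (Primrec.const 2))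
    (Primrec.const 0)) (Primrec.nat_div.comp Primrec.encode (Primrec.const 2))
    (Primrec.const 0)).of_eq fun z => ?_
  cases z with
  | ofNat n =>
    have h : Encodable.encode (Int.ofNat n) = 2 * n := rfl
    rw [h, if_pos (by omega), Nat.mul_div_cancel_left _ two_pos]
    rfl
  | negSucc n =>
    have h : Encodable.encode (Int.negSucc n) = 2 * n + 1 := rfl
    rw [h, if_neg (by omega)]
    rfl

theorem primrec_intToNat_neg : Primrec fun z : ℤ => (-z).toNat := by
  refine (Primrec.ite (Primrec.eq.comp (Primrec.nat_mod.comp Primrec.encode (Primrec.const 2))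
    (Primrec.const 0)) (Primrec.const 0)
    (Primrec.succ.comp (Primrec.nat_div.comp Primrec.encode (Primrec.const 2)))).of_eq fun z => ?_
  cases z with
  | ofNat n =>
    have h : Encodable.encode (Int.ofNat n) = 2 * n := rfl
    rw [h, if_pos (by omega)]
    exact (Int.toNat_of_nonpos (by simp)).symm
  | negSucc n =>
    have h : Encodable.encode (Int.negSucc n) = 2 * n + 1 := rfl
    rw [h, if_neg (by omega), show (2 * n + 1) / 2 = n by omega]
    rfl

theorem primrec_natAbs : Primrec Int.natAbs :=
  (Primrec.nat_add.comp primrec_intToNat primrec_intToNat_neg).of_eq fun z => by omega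

/-- The absolute value of a determinant in terms of truncated subtraction of natural numbers, the
integers being split into positive and negative parts. -/
theorem natAbs_det_eq (x y : ℤ × ℤ) : (det x y).natAbs =
    (x.1.toNat * y.2.toNat + (-x.1).toNat * (-y.2).toNat +
      (x.2.toNat * (-y.1).toNat + (-x.2).toNat * y.1.toNat) -
    (x.1.toNat * (-y.2).toNat + (-x.1).toNat * y.2.toNat +
      (x.2.toNat * y.1.toNat + (-x.2).toNat * (-y.1).toNat))) +
    (x.1.toNat * (-y.2).toNat + (-x.1).toNat * y.2.toNat +
      (x.2.toNat * y.1.toNat + (-x.2).toNat * (-y.1).toNat) -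
    (x.1.toNat * y.2.toNat + (-x.1).toNat * (-y.2).toNat +
      (x.2.toNat * (-y.1).toNat + (-x.2).toNat * y.1.toNat))) := by
  have h : ∀ z : ℤ, z = z.toNat - (-z).toNat := fun z => by omega
  have h1 : det x y = ((x.1.toNat * y.2.toNat + (-x.1).toNat * (-y.2).toNat +
      (x.2.toNat * (-y.1).toNat + (-x.2).toNat * y.1.toNat) : ℕ) : ℤ) -
    ((x.1.toNat * (-y.2).toNat + (-x.1).toNat * y.2.toNat +
      (x.2.toNat * y.1.toNat + (-x.2).toNat * (-y.1).toNat) : ℕ) : ℤ) := by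
    unfold det
    conv_lhs => rw [h x.1, h x.2, h y.1, h y.2]
    push_cast
    ring
  rw [h1]
  omega

theorem primrec_natAbs_det : Primrec₂ fun x y : ℤ × ℤ => (det x y).natAbs := by
  have x1 : Primrec fun p : (ℤ × ℤ) × (ℤ × ℤ) => p.1.1 := Primrec.fst.comp Primrec.fst
  have x2 : Primrec fun p : (ℤ × ℤ) × (ℤ × ℤ) => p.1.2 := Primrec.snd.comp Primrec.fst
  have y1 : Primrec fun p : (ℤ × ℤ) × (ℤ × ℤ) => p.2.1 := Primrec.fst.comp Primrec.snd
  have y2 : Primrec fun p : (ℤ × ℤ) × (ℤ × ℤ) => p.2.2 := Primrec.snd.comp Primrec.snd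
  have pos := fun {f : (ℤ × ℤ) × (ℤ × ℤ) → ℤ} (hf : Primrec f) => primrec_intToNat.comp hf
  have neg := fun {f : (ℤ × ℤ) × (ℤ × ℤ) → ℤ} (hf : Primrec f) => primrec_intToNat_neg.comp hf
  have mul := fun {f g : (ℤ × ℤ) × (ℤ × ℤ) → ℕ} (hf : Primrec f) (hg : Primrec g) =>
    Primrec.nat_mul.comp hf hg
  have add := fun {f g : (ℤ × ℤ) × (ℤ × ℤ) → ℕ} (hf : Primrec f) (hg : Primrec g) =>
    Primrec.nat_add.comp hf hg
  have hp := add (add (mul (pos x1) (pos y2)) (mul (neg x1) (neg y2)))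
    (add (mul (pos x2) (neg y1)) (mul (neg x2) (pos y1)))
  have hn := add (add (mul (pos x1) (neg y2)) (mul (neg x1) (pos y2)))
    (add (mul (pos x2) (pos y1)) (mul (neg x2) (neg y1)))
  exact (add (Primrec.nat_sub.comp hp hn) (Primrec.nat_sub.comp hn hp)).of_eq
    fun p => (natAbs_det_eq p.1 p.2).symm

end PrimitiveRecursion

/-! ### The algorithm -/

section Algorithm

/-- The vector number `a` in a list of pairs of vectors: the vectors of the pair number `i` have
numbers `2 i` and `2 i + 1`. -/
def nthVector (l : List ((ℤ × ℤ) × (ℤ × ℤ))) (a : ℕ) : ℤ × ℤ :=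
  if a % 2 = 0 then (l.getD (a / 2) 0).1 else (l.getD (a / 2) 0).2

/-- The absolute values of the determinants of the vectors in a list. -/
def detEntry (l : List ((ℤ × ℤ) × (ℤ × ℤ))) (a b : ℕ) : ℕ :=
  (det (nthVector l a) (nthVector l b)).natAbs

/-- The sum of the absolute values of all the coordinates in a list of pairs of vectors. -/
def coordSum (l : List ((ℤ × ℤ) × (ℤ × ℤ))) : ℕ :=
  l.foldr (fun p s => p.1.1.natAbs + p.1.2.natAbs + (p.2.1.natAbs + p.2.2.natAbs) + s) 0

/-- A number divisible by all nonzero coordinates and determinants of the vectors in a list. -/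
def commonMultiple (l : List ((ℤ × ℤ) × (ℤ × ℤ))) : ℕ :=
  (2 * (coordSum l * coordSum l) + coordSum l).factorial

/-- A strict upper bound for the entries of the regulating tuples to be tried. -/
def entryBound (l : List ((ℤ × ℤ) × (ℤ × ℤ))) : ℕ :=
  commonMultiple l ^ l.length + 1

/-- The entry number `i` of the tuple encoded by `x`, in base `entryBound l`. -/
def tupleEntry (l : List ((ℤ × ℤ) × (ℤ × ℤ))) (x i : ℕ) : ℕ :=
  x / entryBound l ^ i % entryBound l

/-- The absolute values of the determinants of the vectors in a list, multiplied by the entries of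
the tuple encoded by `x`. -/
def scaledEntry (l : List ((ℤ × ℤ) × (ℤ × ℤ))) (x a b : ℕ) : ℕ :=
  tupleEntry l x (a / 2) * tupleEntry l x (b / 2) * detEntry l a b

/-- The greatest common divisor of a row of the matrix of scaled determinants. -/
def rowGcd (l : List ((ℤ × ℤ) × (ℤ × ℤ))) (x a : ℕ) : ℕ :=
  (List.range (2 * l.length)).foldr (fun b d => Nat.gcd (scaledEntry l x a b) d) 0

/-- All the vectors in the list are parallel to each other. -/
def IsDegenerate (l : List ((ℤ × ℤ) × (ℤ × ℤ))) : Prop :=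
  ∀ a < 2 * l.length, ∀ b < 2 * l.length, detEntry l a b = 0

/-- The property that the algorithm decides: the vectors are parallel and those of each pair agree
up to sign, or the vectors are not all parallel and one of finitely many tuples satisfies the
criterion of greatest common divisors. -/
def IsAccepted (l : List ((ℤ × ℤ) × (ℤ × ℤ))) : Prop :=
  (IsDegenerate l ∧ ∀ i < l.length,
    (nthVector l (2 * i)).1.natAbs = (nthVector l (2 * i + 1)).1.natAbs ∧
    (nthVector l (2 * i)).2.natAbs = (nthVector l (2 * i + 1)).2.natAbs) ∨
  (¬ IsDegenerate l ∧ ∃ x < entryBound l ^ l.length,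
    (∀ i < l.length, tupleEntry l x i ≠ 0) ∧
    ∀ a < 2 * l.length, ∀ b < 2 * l.length, ∀ c < 2 * l.length, rowGcd l x a ∣ scaledEntry l x b c)

theorem primrec_nthVector : Primrec₂ nthVector := by
  have h : Primrec fun p : List ((ℤ × ℤ) × (ℤ × ℤ)) × ℕ => p.1.getD (p.2 / 2) 0 :=
    (Primrec.list_getD 0).comp Primrec.fst (Primrec.nat_div.comp Primrec.snd (Primrec.const 2))
  exact Primrec.ite (Primrec.eq.comp (Primrec.nat_mod.comp Primrec.snd (Primrec.const 2))
    (Primrec.const 0)) (Primrec.fst.comp h) (Primrec.snd.comp h)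

theorem primrec_detEntry {α : Type*} [Primcodable α] {f : α → List ((ℤ × ℤ) × (ℤ × ℤ))}
    {g h : α → ℕ} (hf : Primrec f) (hg : Primrec g) (hh : Primrec h) :
    Primrec fun x => detEntry (f x) (g x) (h x) :=
  primrec_natAbs_det.comp (primrec_nthVector.comp hf hg) (primrec_nthVector.comp hf hh)

theorem primrec_coordSum : Primrec coordSum := by
  have n11 : Primrec fun x : List ((ℤ × ℤ) × (ℤ × ℤ)) × (((ℤ × ℤ) × (ℤ × ℤ)) × ℕ) =>
      x.2.1.1.1.natAbs := primrec_natAbs.comp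
        (Primrec.fst.comp (Primrec.fst.comp (Primrec.fst.comp Primrec.snd)))
  have n12 : Primrec fun x : List ((ℤ × ℤ) × (ℤ × ℤ)) × (((ℤ × ℤ) × (ℤ × ℤ)) × ℕ) =>
      x.2.1.1.2.natAbs := primrec_natAbs.comp
        (Primrec.snd.comp (Primrec.fst.comp (Primrec.fst.comp Primrec.snd)))
  have n21 : Primrec fun x : List ((ℤ × ℤ) × (ℤ × ℤ)) × (((ℤ × ℤ) × (ℤ × ℤ)) × ℕ) =>
      x.2.1.2.1.natAbs := primrec_natAbs.comp
        (Primrec.fst.comp (Primrec.snd.comp (Primrec.fst.comp Primrec.snd)))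
  have n22 : Primrec fun x : List ((ℤ × ℤ) × (ℤ × ℤ)) × (((ℤ × ℤ) × (ℤ × ℤ)) × ℕ) =>
      x.2.1.2.2.natAbs := primrec_natAbs.comp
        (Primrec.snd.comp (Primrec.snd.comp (Primrec.fst.comp Primrec.snd)))
  have h : Primrec₂ fun (_ : List ((ℤ × ℤ) × (ℤ × ℤ))) (p : ((ℤ × ℤ) × (ℤ × ℤ)) × ℕ) =>
      p.1.1.1.natAbs + p.1.1.2.natAbs + (p.1.2.1.natAbs + p.1.2.2.natAbs) + p.2 :=
    Primrec.nat_add.comp (Primrec.nat_add.comp (Primrec.nat_add.comp n11 n12)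
      (Primrec.nat_add.comp n21 n22)) (Primrec.snd.comp Primrec.snd)
  exact Primrec.list_foldr Primrec.id (Primrec.const 0) h

theorem primrec_entryBound : Primrec entryBound := by
  have h1 : Primrec commonMultiple := primrec_factorial.comp
    (Primrec.nat_add.comp (Primrec.nat_mul.comp (Primrec.const 2)
      (Primrec.nat_mul.comp primrec_coordSum primrec_coordSum)) primrec_coordSum)
  exact Primrec.succ.comp (primrec_pow.comp h1 Primrec.list_length)

theorem primrec_tupleEntry {α : Type*} [Primcodable α] {f : α → List ((ℤ × ℤ) × (ℤ × ℤ))}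
    {g h : α → ℕ} (hf : Primrec f) (hg : Primrec g) (hh : Primrec h) :
    Primrec fun x => tupleEntry (f x) (g x) (h x) :=
  Primrec.nat_mod.comp
    (Primrec.nat_div.comp hg (primrec_pow.comp (primrec_entryBound.comp hf) hh))
    (primrec_entryBound.comp hf)

theorem primrec_scaledEntry {α : Type*} [Primcodable α] {f : α → List ((ℤ × ℤ) × (ℤ × ℤ))}
    {g h i : α → ℕ} (hf : Primrec f) (hg : Primrec g) (hh : Primrec h) (hi : Primrec i) :
    Primrec fun x => scaledEntry (f x) (g x) (h x) (i x) :=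
  Primrec.nat_mul.comp (Primrec.nat_mul.comp
    (primrec_tupleEntry hf hg (Primrec.nat_div.comp hh (Primrec.const 2)))
    (primrec_tupleEntry hf hg (Primrec.nat_div.comp hi (Primrec.const 2))))
    (primrec_detEntry hf hh hi)

theorem primrec_two_mul_length {α : Type*} [Primcodable α]
    {f : α → List ((ℤ × ℤ) × (ℤ × ℤ))} (hf : Primrec f) : Primrec fun x => 2 * (f x).length :=
  Primrec.nat_mul.comp (Primrec.const 2) (Primrec.list_length.comp hf)

theorem primrec_rowGcd {α : Type*} [Primcodable α] {f : α → List ((ℤ × ℤ) × (ℤ × ℤ))}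
    {g h : α → ℕ} (hf : Primrec f) (hg : Primrec g) (hh : Primrec h) :
    Primrec fun x => rowGcd (f x) (g x) (h x) := by
  have h1 : Primrec₂ fun (x : α) (p : ℕ × ℕ) =>
      Nat.gcd (scaledEntry (f x) (g x) (h x) p.1) p.2 :=
    primrec_gcd.comp
      (primrec_scaledEntry (hf.comp Primrec.fst) (hg.comp Primrec.fst) (hh.comp Primrec.fst)
        (Primrec.fst.comp Primrec.snd))
      (Primrec.snd.comp Primrec.snd)
  exact Primrec.list_foldr (Primrec.list_range.comp (primrec_two_mul_length hf))
    (Primrec.const 0) h1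

theorem primrecPred_isDegenerate : PrimrecPred IsDegenerate := by
  have h1 : PrimrecRel fun (b : ℕ) (p : ℕ × List ((ℤ × ℤ) × (ℤ × ℤ))) =>
      detEntry p.2 p.1 b = 0 :=
    Primrec.eq.comp (primrec_detEntry (Primrec.snd.comp Primrec.snd)
      (Primrec.fst.comp Primrec.snd) Primrec.fst) (Primrec.const 0)
  have h2 : PrimrecRel fun (a : ℕ) (l : List ((ℤ × ℤ) × (ℤ × ℤ))) =>
      ∀ b < 2 * l.length, detEntry l a b = 0 :=
    h1.forall_lt_of (primrec_two_mul_length Primrec.snd)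
  exact h2.forall_lt_of (primrec_two_mul_length Primrec.id)

theorem primrecPred_isAccepted : PrimrecPred IsAccepted := by
  refine PrimrecPred.or (primrecPred_isDegenerate.and ?_) (primrecPred_isDegenerate.not.and ?_)
  · have h0 : Primrec fun p : ℕ × List ((ℤ × ℤ) × (ℤ × ℤ)) => nthVector p.2 (2 * p.1) :=
      primrec_nthVector.comp Primrec.snd (Primrec.nat_mul.comp (Primrec.const 2) Primrec.fst)
    have h1 : Primrec fun p : ℕ × List ((ℤ × ℤ) × (ℤ × ℤ)) => nthVector p.2 (2 * p.1 + 1) :=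
      primrec_nthVector.comp Primrec.snd
        (Primrec.succ.comp (Primrec.nat_mul.comp (Primrec.const 2) Primrec.fst))
    have h2 : PrimrecRel fun (i : ℕ) (l : List ((ℤ × ℤ) × (ℤ × ℤ))) =>
        (nthVector l (2 * i)).1.natAbs = (nthVector l (2 * i + 1)).1.natAbs ∧
        (nthVector l (2 * i)).2.natAbs = (nthVector l (2 * i + 1)).2.natAbs :=
      PrimrecPred.and
        (Primrec.eq.comp (primrec_natAbs.comp (Primrec.fst.comp h0))
          (primrec_natAbs.comp (Primrec.fst.comp h1)))
        (Primrec.eq.comp (primrec_natAbs.comp (Primrec.snd.comp h0))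
          (primrec_natAbs.comp (Primrec.snd.comp h1)))
    exact h2.forall_lt_of Primrec.list_length
  · have h1 : PrimrecRel fun (i : ℕ) (p : ℕ × List ((ℤ × ℤ) × (ℤ × ℤ))) =>
        tupleEntry p.2 p.1 i ≠ 0 :=
      (Primrec.eq.comp (primrec_tupleEntry (Primrec.snd.comp Primrec.snd)
        (Primrec.fst.comp Primrec.snd) Primrec.fst) (Primrec.const 0)).not
    have h2 : PrimrecRel fun (c : ℕ) (p : ℕ × ℕ × ℕ × List ((ℤ × ℤ) × (ℤ × ℤ))) =>
        rowGcd p.2.2.2 p.2.2.1 p.2.1 ∣ scaledEntry p.2.2.2 p.2.2.1 p.1 c := by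
      have e1 : Primrec fun q : ℕ × ℕ × ℕ × ℕ × List ((ℤ × ℤ) × (ℤ × ℤ)) => q.2.2.2 :=
        Primrec.snd.comp (Primrec.snd.comp Primrec.snd)
      exact primrecRel_dvd.comp
        (primrec_rowGcd (Primrec.snd.comp e1) (Primrec.fst.comp e1)
          (Primrec.fst.comp (Primrec.snd.comp Primrec.snd)))
        (primrec_scaledEntry (Primrec.snd.comp e1) (Primrec.fst.comp e1)
          (Primrec.fst.comp Primrec.snd) Primrec.fst)
    have h3 : PrimrecRel fun (b : ℕ) (p : ℕ × ℕ × List ((ℤ × ℤ) × (ℤ × ℤ))) =>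
        ∀ c < 2 * p.2.2.length, rowGcd p.2.2 p.2.1 p.1 ∣ scaledEntry p.2.2 p.2.1 b c :=
      h2.forall_lt_of (primrec_two_mul_length
        (Primrec.snd.comp (Primrec.snd.comp Primrec.snd)))
    have h4 : PrimrecRel fun (a : ℕ) (p : ℕ × List ((ℤ × ℤ) × (ℤ × ℤ))) =>
        ∀ b < 2 * p.2.length, ∀ c < 2 * p.2.length,
          rowGcd p.2 p.1 a ∣ scaledEntry p.2 p.1 b c :=
      h3.forall_lt_of (primrec_two_mul_length (Primrec.snd.comp Primrec.snd))
    have h5 : PrimrecRel fun (x : ℕ) (l : List ((ℤ × ℤ) × (ℤ × ℤ))) =>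
        (∀ i < l.length, tupleEntry l x i ≠ 0) ∧
        ∀ a < 2 * l.length, ∀ b < 2 * l.length, ∀ c < 2 * l.length,
          rowGcd l x a ∣ scaledEntry l x b c :=
      PrimrecPred.and
        (h1.forall_lt_of (Primrec.list_length.comp Primrec.snd))
        (h4.forall_lt_of (primrec_two_mul_length Primrec.snd))
    exact h5.exists_lt_of (primrec_pow.comp primrec_entryBound Primrec.list_length)

end Algorithm

/-! ### Correctness of the algorithm -/

section Correctness

/-- The vectors of a list of pairs, indexed like the ends of the edges. -/
def listVector (l : List ((ℤ × ℤ) × (ℤ × ℤ))) (x : Fin l.length × Bool) : ℤ × ℤ :=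
  if x.2 then (l.get x.1).1 else (l.get x.1).2

/-- The position of a vector in the enumeration `nthVector`. -/
def vectorNumber {n : ℕ} (x : Fin n × Bool) : ℕ := 2 * x.1 + if x.2 then 0 else 1

theorem vectorNumber_lt {n : ℕ} (x : Fin n × Bool) : vectorNumber x < 2 * n := by
  have := x.1.2
  unfold vectorNumber
  split_ifs <;> omega

theorem vectorNumber_div_two {n : ℕ} (x : Fin n × Bool) : vectorNumber x / 2 = x.1 := by
  unfold vectorNumber
  split_ifs <;> omega

theorem forall_lt_two_mul_iff {n : ℕ} {p : ℕ → Prop} :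
    (∀ a < 2 * n, p a) ↔ ∀ x : Fin n × Bool, p (vectorNumber x) := by
  refine ⟨fun h x => h _ (vectorNumber_lt x), fun h a ha => ?_⟩
  have h1 := h (⟨a / 2, by omega⟩, a % 2 == 0)
  have h2 : vectorNumber ((⟨a / 2, by omega⟩ : Fin n), a % 2 == 0) = a := by
    simp only [vectorNumber, beq_iff_eq]
    split_ifs <;> omega
  rwa [h2] at h1

theorem nthVector_vectorNumber (l : List ((ℤ × ℤ) × (ℤ × ℤ))) (x : Fin l.length × Bool) :
    nthVector l (vectorNumber x) = listVector l x := by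
  unfold nthVector listVector
  rw [vectorNumber_div_two, List.getD_eq_getElem _ _ x.1.2]
  obtain ⟨i, b⟩ := x
  cases b
  · rw [if_neg (by simp [vectorNumber])]
    rfl
  · rw [if_pos (by simp [vectorNumber])]
    rfl

theorem natAbs_le_coordSum {l : List ((ℤ × ℤ) × (ℤ × ℤ))} {p : (ℤ × ℤ) × (ℤ × ℤ)} (hp : p ∈ l) :
    p.1.1.natAbs + p.1.2.natAbs + (p.2.1.natAbs + p.2.2.natAbs) ≤ coordSum l := by
  induction l with
  | nil => simp at hp
  | cons q l ih =>
    have h : coordSum (q :: l) =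
      q.1.1.natAbs + q.1.2.natAbs + (q.2.1.natAbs + q.2.2.natAbs) + coordSum l := rfl
    rcases List.mem_cons.1 hp with rfl | hp
    · omega
    · have := ih hp
      omega

theorem listVector_le_coordSum (l : List ((ℤ × ℤ) × (ℤ × ℤ))) (x : Fin l.length × Bool) :
    (listVector l x).1.natAbs ≤ coordSum l ∧ (listVector l x).2.natAbs ≤ coordSum l := by
  have := natAbs_le_coordSum (List.get_mem l x.1)
  unfold listVector
  split_ifs <;> omega

theorem dvd_commonMultiple_of_natAbs_le {l : List ((ℤ × ℤ) × (ℤ × ℤ))} {d : ℤ} (hd : d ≠ 0)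
    (h : d.natAbs ≤ 2 * (coordSum l * coordSum l) + coordSum l) : d ∣ (commonMultiple l : ℤ) :=
  Int.dvd_natCast.2 (Nat.dvd_factorial (Int.natAbs_pos.2 hd) h)

theorem det_natAbs_le {x y : ℤ × ℤ} {s : ℕ} (hx : x.1.natAbs ≤ s ∧ x.2.natAbs ≤ s)
    (hy : y.1.natAbs ≤ s ∧ y.2.natAbs ≤ s) : (det x y).natAbs ≤ 2 * (s * s) := by
  have h1 : (x.1 * y.2).natAbs ≤ s * s := by
    rw [Int.natAbs_mul]; exact Nat.mul_le_mul hx.1 hy.2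
  have h2 : (x.2 * y.1).natAbs ≤ s * s := by
    rw [Int.natAbs_mul]; exact Nat.mul_le_mul hx.2 hy.1
  have h3 := Int.natAbs_sub_le (x.1 * y.2) (x.2 * y.1)
  unfold det
  omega

theorem eq_or_eq_neg_iff_natAbs {x y : ℤ × ℤ} (h : det x y = 0) :
    x = y ∨ x = -y ↔ x.1.natAbs = y.1.natAbs ∧ x.2.natAbs = y.2.natAbs := by
  constructor
  · rintro (rfl | rfl) <;> simp
  · rintro ⟨h1, h2⟩
    unfold det at h
    rcases Int.natAbs_eq_natAbs_iff.1 h1 with h1 | h1 <;>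
      rcases Int.natAbs_eq_natAbs_iff.1 h2 with h2 | h2
    · exact Or.inl (Prod.ext h1 h2)
    · have h3 : y.1 * y.2 = 0 := by rw [h1, h2] at h; linarith
      rcases mul_eq_zero.1 h3 with h4 | h4
      · exact Or.inr (Prod.ext (by simp [h1, h4]) h2)
      · exact Or.inl (Prod.ext h1 (by simp [h2, h4]))
    · have h3 : y.1 * y.2 = 0 := by rw [h1, h2] at h; linarith
      rcases mul_eq_zero.1 h3 with h4 | h4
      · exact Or.inl (Prod.ext (by simp [h1, h4]) h2)
      · exact Or.inr (Prod.ext h1 (by simp [h2, h4]))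
    · exact Or.inr (Prod.ext h1 h2)

theorem dvd_foldr_gcd_iff {f : ℕ → ℕ} {d : ℕ} (s : List ℕ) :
    d ∣ s.foldr (fun b g => Nat.gcd (f b) g) 0 ↔ ∀ b ∈ s, d ∣ f b := by
  induction s with
  | nil => simp
  | cons a s ih => simp [Nat.dvd_gcd_iff, ih]

/-- Every tuple of `n` numbers below `B` is the sequence of digits of a number below `B ^ n`. -/
theorem exists_digits {n B : ℕ} (k : Fin n → ℕ) (hk : ∀ i, k i < B) :
    ∃ x < B ^ n, ∀ i : Fin n, x / B ^ (i : ℕ) % B = k i := by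
  let f : Fin n → Fin B := fun i => ⟨k i, hk i⟩
  refine ⟨finFunctionFinEquiv f, (finFunctionFinEquiv f).2, fun i => ?_⟩
  have h := congrFun (finFunctionFinEquiv.symm_apply_apply f) i
  have h2 := congrArg Fin.val h
  rwa [finFunctionFinEquiv_symm_apply_val] at h2

theorem isDegenerate_iff (l : List ((ℤ × ℤ) × (ℤ × ℤ))) :
    IsDegenerate l ↔ ∀ a b, det (listVector l a) (listVector l b) = 0 := by
  simp only [IsDegenerate, forall_lt_two_mul_iff, detEntry, nthVector_vectorNumber,
    Int.natAbs_eq_zero]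

/-- The algorithm decides the existence of a regulating tuple. -/
theorem isAccepted_iff {l : List ((ℤ × ℤ) × (ℤ × ℤ))} (hl : ∀ x, listVector l x ≠ 0) :
    IsAccepted l ↔ ∃ k, IsRegulated (listVector l) k := by
  unfold IsAccepted
  by_cases hdeg : IsDegenerate l
  · have hdet := (isDegenerate_iff l).1 hdeg
    simp only [hdeg, true_and, not_true_eq_false, false_and, or_false]
    rw [exists_isRegulated_iff_of_det_eq_zero hl hdet]
    simp only [eq_or_eq_neg_iff_natAbs (hdet _ _)]
    have h1 : ∀ i : Fin l.length, nthVector l (2 * i) = listVector l (i, true) :=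
      fun i => nthVector_vectorNumber l (i, true)
    have h2 : ∀ i : Fin l.length, nthVector l (2 * i + 1) = listVector l (i, false) :=
      fun i => nthVector_vectorNumber l (i, false)
    constructor
    · intro h i
      rw [← h1, ← h2]
      exact h i i.2
    · intro h i hi
      have := h ⟨i, hi⟩
      rwa [← h1, ← h2] at this
  · simp only [hdeg, false_and, not_false_eq_true, true_and, false_or]
    rw [isDegenerate_iff] at hdeg
    push Not at hdeg
    have hM : commonMultiple l ≠ 0 := Nat.factorial_ne_zero _
    rw [exists_isRegulated_iff_of_det_ne_zero hdeg hM
      (fun a b hab => dvd_commonMultiple_of_natAbs_le hab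
        ((det_natAbs_le (listVector_le_coordSum l a) (listVector_le_coordSum l b)).trans
          (Nat.le_add_right _ _)))
      (fun a => by
        by_cases h1 : (listVector l a).1 = 0
        · have h2 : (listVector l a).2 ≠ 0 := fun h2 => hl a (Prod.ext h1 h2)
          exact Or.inr (dvd_commonMultiple_of_natAbs_le h2
            ((listVector_le_coordSum l a).2.trans (Nat.le_add_left _ _)))
        · exact Or.inl (dvd_commonMultiple_of_natAbs_le h1
            ((listVector_le_coordSum l a).1.trans (Nat.le_add_left _ _))))]
    have hscaled : ∀ (x : ℕ) (a b : Fin l.length × Bool),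
        scaledEntry l x (vectorNumber a) (vectorNumber b) =
          tupleEntry l x a.1 * tupleEntry l x b.1 *
            (det (listVector l a) (listVector l b)).natAbs := by
      intro x a b
      rw [scaledEntry, detEntry, nthVector_vectorNumber, nthVector_vectorNumber,
        vectorNumber_div_two, vectorNumber_div_two]
    have hgcd : ∀ (x : ℕ) (a : Fin l.length × Bool), rowGcd l x (vectorNumber a) =
        Finset.univ.gcd fun b : Fin l.length × Bool => tupleEntry l x a.1 * tupleEntry l x b.1 *
            (det (listVector l a) (listVector l b)).natAbs := by
      intro x a
      refine Nat.dvd_left_iff_eq.1 fun d => ?_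
      rw [rowGcd, dvd_foldr_gcd_iff, Finset.dvd_gcd_iff]
      simp only [List.mem_range, forall_lt_two_mul_iff, hscaled, Finset.mem_univ, true_imp_iff]
    simp only [forall_lt_two_mul_iff, hscaled, hgcd]
    constructor
    · rintro ⟨x, -, h0, h⟩
      refine ⟨fun i => tupleEntry l x i, fun i => ⟨h0 i i.2, ?_⟩, h⟩
      exact Nat.lt_succ_iff.1 (Nat.mod_lt _ (Nat.succ_pos _))
    · rintro ⟨k, hk, h⟩
      obtain ⟨x, hx, hxk⟩ := exists_digits (B := entryBound l) k
        fun i => Nat.lt_succ_of_le (hk i).2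
      have hxk' : ∀ i : Fin l.length, tupleEntry l x i = k i := hxk
      refine ⟨x, hx, fun i hi => ?_, ?_⟩
      · have := hxk' ⟨i, hi⟩
        rw [show tupleEntry l x i = _ from this]
        exact (hk _).1
      · simpa only [hxk'] using h

theorem exists_isRegulated_reindex {ι κ : Type*} (σ : ι ≃ κ) {w : ι × Bool → ℤ × ℤ}
    {w' : κ × Bool → ℤ × ℤ} (h : ∀ x, w x = w' (σ x.1, x.2)) :
    (∃ k, IsRegulated w k) ↔ ∃ k, IsRegulated w' k := by
  have key : ∀ k : κ → ℤ, IsRegulated w (k ∘ σ) ↔ IsRegulated w' k := by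
    intro k
    have hrange : Set.range (fun x : ι × Bool => (k ∘ σ) x.1 • w x) =
        Set.range (fun x : κ × Bool => k x.1 • w' x) := by
      rw [← (σ.prodCongr (Equiv.refl Bool)).surjective.range_comp]
      congr 1
      funext ⟨i, b⟩
      simp [h]
    unfold IsRegulated
    rw [hrange, ← (σ.prodCongr (Equiv.refl Bool)).forall_congr_right]
    simp [h]
  constructor
  · rintro ⟨k, hk⟩
    refine ⟨k ∘ σ.symm, (key _).1 ?_⟩
    have : (k ∘ σ.symm) ∘ σ = k := by funext i; simp
    rwa [this]
  · rintro ⟨k, hk⟩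
    exact ⟨k ∘ σ, (key k).2 hk⟩

end Correctness

namespace OneVertexTubular

theorem isAccepted_code_iff {T : OneVertexTubular.{u, v, w}} (M : T.Marking) :
    IsAccepted M.code ↔ ∃ k, IsRegulated (endVector M.coord M.gen) k := by
  have hlen : M.code.length = M.n := List.length_ofFn
  have hvec : ∀ x : Fin M.code.length × Bool, listVector M.code x =
      endVector M.coord M.gen (((finCongr hlen).trans M.edge) x.1, x.2) := by
    rintro ⟨i, b⟩
    have hget : M.code.get i = _ := List.get_ofFn _ i
    cases b <;> simp only [listVector, hget] <;> rfl
  rw [isAccepted_iff fun x => by rw [hvec]; exact endVector_ne_zero _ _ _]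
  exact exists_isRegulated_reindex _ hvec

end OneVertexTubular

theorem mainTheorem2 :
    ∃ f : List ((ℤ × ℤ) × (ℤ × ℤ)) → Bool, Computable f ∧
      ∀ (T : OneVertexTubular.{u, v, w}) (M : T.Marking),
        (f M.code = true ↔ Group.ResiduallyFinite T.TubularGroup) ∧
        (f M.code = true ↔ ∃ k : T.E → ℤ, T.IsRegulating k) := by
  obtain ⟨_, hf⟩ := primrecPred_isAccepted
  refine ⟨fun l => decide (IsAccepted l), hf.to_comp, fun T M => ?_⟩
  rw [decide_eq_true_iff, OneVertexTubular.isAccepted_code_iff]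
  refine ⟨⟨?_, ?_⟩, ?_⟩
  · rintro ⟨k, hk⟩
    exact OneVertexTubular.residuallyFinite_of_isRegulated M.coord M.gen hk
  · exact OneVertexTubular.exists_isRegulated_of_residuallyFinite M.coord M.gen
  · simp only [OneVertexTubular.isRegulating_iff M.coord M.gen]
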